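/- **Proposition (Jacobi equation along an extremal).** Let $\pi\colon Y\to X$ be a fibered manifold (a smooth surjective submersion) with $\dim X=n$ and $\dim Y=n+m$, and let $\lambda$ be a Lagrangian of order $r$ on it, i.e. a smooth fibered morphism $J^r\pi\to\Lambda^nT^*X$ over $X$; in fibered coordinates $(x^i,y^\sigma)$, $\lambda=L\,ds$ with $ds=dx^1\wedge\dots\wedge dx^n$. Let $$E_n(\lambda)=E_\sigma(\lambda)\,\omega^\sigma\wedge ds,\qquad E_\sigma(\lambda)=\sum_{|J|\le r}(-1)^{|J|}d_J\Big(\frac{\partial L}{\partial y^\sigma_J}\Big)$$ be its Euler–Lagrange form, where $\omega^\sigma=dy^\sigma-y^\sigma_i\,dx^i$, $J$ runs over symmetric multi-indices and $d_J$ denotes iterated total derivatives. For a smooth vertical vector field $\Xi=\Xi^\sigma\,\partial/\partial y^\sigma$ on an open subset of $Y$, let $$\mathcal J_\Xi(\lambda)=E_n\big(\Xi\rfloor E_n(\lambda)\big),$$ where $\Xi\rfloor E_n(\lambda)=\Xi^\sigma E_\sigma(\lambda)\,ds$ is regarded as a Lagrangian of order $2r$. The equation $\mathcal J_\Xi(\lambda)=0$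 is the Jacobi equation. Let $\gamma$ be a smooth section of $\pi$ over an open set $U\subseteq X$ that is an extremal of the action of $\lambda$, i.e. $\int_D (L_{J^r\Xi}\lambda)\circ j^r\gamma=0$ for all $D\subseteq U$ and all vertical vector fields $\Xi$ on $Y$ such that $\Xi\circ\gamma$ is supported in $D$. (It is enough to test this on compact sets $D$ for which $\gamma(D)$ lies in the domain of one fibered chart.) Then: 1. Along $\gamma$, $\mathcal J_\Xi(\lambda)$ depends only on the values of $\Xi$ along $\gamma$: if $\Xi_1,\Xi_2$ are vertical vector fields on open sets $W_1,W_2\subseteq Y$ with $\Xi_1(\gamma(x))=\Xi_2(\gamma(x))$ for all $x\in U$ with $\gamma(x)\in W_1\cap W_2$, then $\mathcal J_{\Xi_1}(\lambda)$ and $\mathcal J_{\Xi_2}(\lambda)$ have the same value at the jet $j^{4r}_x\gamma$, for all such $x$. In particular, along $\gamma$ the Jacobi equation for $\Xi_1$ is equivalent to that for $\Xi_2$ when $\Xi_1,\Xi_2$ are vertical vector fields on $Y$ with $\Xi_1\circ\gamma=\Xi_2\circ\gamma$. 2. Hence Jacobi fields along $\gamma$ are well defined. Let $\nu$ be a smooth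 vertical vector field along $\gamma$ over $U$. Near every point of $\gamma(U)$, $\nu$ extends to a vertical vector field on an open subset of $Y$. Call $\nu$ a Jacobi field along $\gamma$ if near every point of $\gamma(U)$ some such extension satisfies the Jacobi equation along $\gamma$. Then $\nu$ is a Jacobi field along $\gamma$ if and only if every vertical vector field $\Xi$ on an open subset $W\subseteq Y$ that extends $\nu$ (i.e. $\Xi(\gamma(x))=\nu(x)$ whenever $x\in U$, $\gamma(x)\in W$) satisfies the Jacobi equation along $\gamma$ (at all $x\in U$ with $\gamma(x)\in W$); and if $\gamma(U)\subseteq W$, then $\nu$ is a Jacobi field along $\gamma$ if and only if the single extension $\Xi$ satisfies it. -/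

import Mathlib

open scoped Manifold ContDiff Topology
open MeasureTheory

noncomputable section

namespace VarJet

/-! ### Multi-indices and coordinates on jet spaces -/

/-- Symmetric multi-indices in `n` variables of length `≤ k`: `J i` is the number of occurrences
of the index `i`. They correspond to the nondecreasing tuples of indices of length `≤ k`. -/
abbrev MultiIndex (n k : ℕ) : Type := {J : Fin n → ℕ // ∑ i, J i ≤ k}

instance MultiIndex.instFinite (n k : ℕ) : Finite (MultiIndex n k) := by
  refine Finite.of_injective
    (fun (J : MultiIndex n k) (i : Fin n) => (⟨J.1 i, ?_⟩ : Fin (k + 1))) ?_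
  · exact Nat.lt_succ_of_le
      ((Finset.single_le_sum (f := J.1) (fun _ _ => Nat.zero_le _) (Finset.mem_univ i)).trans J.2)
  · intro J K h
    apply Subtype.ext
    funext i
    exact congrArg Fin.val (congrFun h i)

instance MultiIndex.instFintype (n k : ℕ) : Fintype (MultiIndex n k) := Fintype.ofFinite _

/-- The multi-index of length `0`. -/
def MultiIndex.zero (n k : ℕ) : MultiIndex n k := ⟨0, by simp⟩

/-- The nondecreasing tuple of indices underlying a multi-index. -/
def indexList {n : ℕ} (J : Fin n → ℕ) : List (Fin n) :=
  (List.finRange n).flatMap fun i => List.replicate (J i) i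

theorem length_indexList {n : ℕ} (J : Fin n → ℕ) : (indexList J).length = ∑ i, J i := by
  simp [indexList, List.length_flatMap, Fin.sum_univ_def]

/-- The multi-index `J i`, that is, `J` with the index `i` appended. -/
def MultiIndex.append {n k : ℕ} (J : MultiIndex n k) (i : Fin n) : MultiIndex n (k + 1) :=
  ⟨J.1 + Pi.single i 1, by
    have h := J.2
    simp only [Pi.add_apply, Finset.sum_add_distrib, Finset.sum_pi_single', Finset.mem_univ,
      if_true]
    omega⟩

/-- The space of the fibered coordinates `(x^i, y^σ_J)`, `|J| ≤ k`, on the `k`-th jet space of a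
fibered manifold with `n`-dimensional base and `m`-dimensional fibres. -/
abbrev JetCoord (n m k : ℕ) : Type :=
  EuclideanSpace ℝ (Fin n) × (MultiIndex n k → EuclideanSpace ℝ (Fin m))

/-- The coordinate expression of the projection `π_{l,k}` from `l`-jets to `k`-jets. -/
def jetProj {n m k l : ℕ} (h : k ≤ l) (p : JetCoord n m l) : JetCoord n m k :=
  (p.1, fun J => p.2 ⟨J.1, J.2.trans h⟩)

/-- The coordinates `(x^i, y^σ)` of the point of the total space under a jet. -/
def jetPoint {n m k : ℕ} (p : JetCoord n m k) :
    EuclideanSpace ℝ (Fin n) × EuclideanSpace ℝ (Fin m) :=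
  (p.1, p.2 (MultiIndex.zero n k))

/-- The coordinate derivative `∂f/∂y^σ_J`. -/
def jetPartial {n m k : ℕ} (J : MultiIndex n k) (σ : Fin m) (f : JetCoord n m k → ℝ)
    (p : JetCoord n m k) : ℝ :=
  fderiv ℝ f p (0, Pi.single J (EuclideanSpace.single σ 1))

/-- The total derivative `d_i f = ∂f/∂x^i + ∑ y^σ_{Ji} ∂f/∂y^σ_J` of a function of order `k`; it is
a function of order `k + 1`. -/
def totalDeriv {n m k : ℕ} (i : Fin n) (f : JetCoord n m k → ℝ) (p : JetCoord n m (k + 1)) : ℝ :=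
  fderiv ℝ f (jetProj (Nat.le_succ k) p)
    (EuclideanSpace.single i 1, fun J => p.2 (J.append i))

/-- The iterated total derivative along a tuple of indices. -/
def iterTotalDeriv {n m k : ℕ} :
    (l : List (Fin n)) → (JetCoord n m k → ℝ) → JetCoord n m (k + l.length) → ℝ
  | [], f => f
  | i :: l, f => totalDeriv i (iterTotalDeriv l f)

/-- The iterated total derivative `d_J f` of a function of order `k`, for `k + |J| ≤ s`, pulled back
to `s`-jets. -/
def totalDerivMulti {n m k s : ℕ} (J : Fin n → ℕ) (h : k + ∑ i, J i ≤ s)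
    (f : JetCoord n m k → ℝ) (p : JetCoord n m s) : ℝ :=
  iterTotalDeriv (indexList J) f (jetProj (by rw [length_indexList]; exact h) p)

/-- The Euler--Lagrange expressions `E_σ(L) = ∑_{|J| ≤ k} (-1)^{|J|} d_J (∂L/∂y^σ_J)` of a Lagrangian
density of order `k`: the components of the Euler--Lagrange form `E_n(L ds) = E_σ(L) ω^σ ∧ ds`. -/
def eulerLagrange {n m : ℕ} (k : ℕ) (L : JetCoord n m k → ℝ) (σ : Fin m)
    (p : JetCoord n m (k + k)) : ℝ :=
  ∑ J : MultiIndex n k, (-1 : ℝ) ^ (∑ i, J.1 i) *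
    totalDerivMulti J.1 (Nat.add_le_add_left J.2 k) (jetPartial J σ L) p

/-- The partial derivative `∂f/∂x^i`. -/
def basePartial {n : ℕ} (i : Fin n) (f : EuclideanSpace ℝ (Fin n) → ℝ)
    (u : EuclideanSpace ℝ (Fin n)) : ℝ :=
  fderiv ℝ f u (EuclideanSpace.single i 1)

/-- The iterated partial derivative `∂^{|J|} f/∂x^J`. -/
def basePartialMulti {n : ℕ} (J : Fin n → ℕ) (f : EuclideanSpace ℝ (Fin n) → ℝ) :
    EuclideanSpace ℝ (Fin n) → ℝ :=
  (indexList J).foldr basePartial f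

/-! ### Fibered manifolds, fibered charts, jets of sections -/

variable {n m : ℕ}
  {X : Type*} [TopologicalSpace X] [ChartedSpace (EuclideanSpace ℝ (Fin n)) X]
  {Y : Type*} [TopologicalSpace Y]
  [ChartedSpace (EuclideanSpace ℝ (Fin n) × EuclideanSpace ℝ (Fin m)) Y]

/-- A local model for the total space: `ℝⁿ × ℝᵐ`. -/
abbrev totalModel (n m : ℕ) :=
  modelWithCornersSelf ℝ (EuclideanSpace ℝ (Fin n) × EuclideanSpace ℝ (Fin m))

/-- A fibered manifold: a smooth surjective submersion. -/
structure IsFiberedManifold (n m : ℕ)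
    {X : Type*} [TopologicalSpace X] [ChartedSpace (EuclideanSpace ℝ (Fin n)) X]
    {Y : Type*} [TopologicalSpace Y]
    [ChartedSpace (EuclideanSpace ℝ (Fin n) × EuclideanSpace ℝ (Fin m)) Y]
    (π : Y → X) : Prop where
  surjective : Function.Surjective π
  isSubmersion : Manifold.IsSubmersion (totalModel n m) (𝓡 n) ∞ π

/-- A fibered chart: charts (of the smooth structures) of the total space and of the base in which
`π` is the projection `(x, y) ↦ x`. -/
structure FiberedChart (n m : ℕ)
    {X : Type*} [TopologicalSpace X] [ChartedSpace (EuclideanSpace ℝ (Fin n)) X]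
    {Y : Type*} [TopologicalSpace Y]
    [ChartedSpace (EuclideanSpace ℝ (Fin n) × EuclideanSpace ℝ (Fin m)) Y]
    (π : Y → X) where
  total : OpenPartialHomeomorph Y (EuclideanSpace ℝ (Fin n) × EuclideanSpace ℝ (Fin m))
  base : OpenPartialHomeomorph X (EuclideanSpace ℝ (Fin n))
  total_mem : total ∈ IsManifold.maximalAtlas (totalModel n m) ∞ Y
  base_mem : base ∈ IsManifold.maximalAtlas (𝓡 n) ∞ X
  mapsTo : Set.MapsTo π total.source base.source
  base_proj : ∀ y ∈ total.source, base (π y) = (total y).1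

/-- `φ` restricts to a smooth section of `π` over the open set `U` (its values off `U` are
irrelevant). -/
structure IsLocalSection (n m : ℕ)
    {X : Type*} [TopologicalSpace X] [ChartedSpace (EuclideanSpace ℝ (Fin n)) X]
    {Y : Type*} [TopologicalSpace Y]
    [ChartedSpace (EuclideanSpace ℝ (Fin n) × EuclideanSpace ℝ (Fin m)) Y]
    (π : Y → X) (U : Set X) (φ : X → Y) : Prop where
  isOpen : IsOpen U
  smooth : ContMDiffOn (𝓡 n) (totalModel n m) ∞ φ U
  section_eq : ∀ x ∈ U, π (φ x) = x

/-- The components `u ↦ φ^σ(u)` of a section in a fibered chart. -/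
def FiberedChart.sectionComp {π : Y → X} (c : FiberedChart n m π) (φ : X → Y) (σ : Fin m)
    (u : EuclideanSpace ℝ (Fin n)) : ℝ :=
  (c.total (φ (c.base.symm u))).2 σ

/-- The coordinates `(x^i, y^σ_J = ∂^{|J|} φ^σ/∂x^J)` of the jet `j^k_x φ` in a fibered chart
around `φ x`. -/
def FiberedChart.jetOf {π : Y → X} (c : FiberedChart n m π) (k : ℕ) (φ : X → Y) (x : X) :
    JetCoord n m k :=
  (c.base x, fun J => WithLp.toLp 2 fun σ =>
    basePartialMulti J.1 (c.sectionComp φ σ) (c.base x))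

/-- Smooth sections defined in a neighbourhood of `x`. -/
def SectionNear (n m : ℕ)
    {X : Type*} [TopologicalSpace X] [ChartedSpace (EuclideanSpace ℝ (Fin n)) X]
    {Y : Type*} [TopologicalSpace Y]
    [ChartedSpace (EuclideanSpace ℝ (Fin n) × EuclideanSpace ℝ (Fin m)) Y]
    (π : Y → X) (x : X) : Type _ :=
  {φ : X → Y // ∃ V : Set X, x ∈ V ∧ IsLocalSection n m π V φ}

/-- Two sections near `x` are identified when they have the same value and the same derivatives up
to order `k` at `x`. -/
def jetSetoid (n m : ℕ)
    {X : Type*} [TopologicalSpace X] [ChartedSpace (EuclideanSpace ℝ (Fin n)) X]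
    {Y : Type*} [TopologicalSpace Y]
    [ChartedSpace (EuclideanSpace ℝ (Fin n) × EuclideanSpace ℝ (Fin m)) Y]
    (π : Y → X) (k : ℕ) (x : X) : Setoid (SectionNear n m π x) where
  r φ ψ := φ.1 x = ψ.1 x ∧
    ∀ c : FiberedChart n m π, φ.1 x ∈ c.total.source → c.jetOf k φ.1 x = c.jetOf k ψ.1 x
  iseqv :=
    { refl := fun _ => ⟨rfl, fun _ _ => rfl⟩
      symm := fun h => ⟨h.1.symm, fun c hc => (h.2 c (h.1 ▸ hc)).symm⟩
      trans := fun h h' => ⟨h.1.trans h'.1,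
        fun c hc => (h.2 c hc).trans (h'.2 c (h.1 ▸ hc))⟩ }

/-- The fibre over `x` of the jet space `J^k π`. -/
def JetAt (n m : ℕ)
    {X : Type*} [TopologicalSpace X] [ChartedSpace (EuclideanSpace ℝ (Fin n)) X]
    {Y : Type*} [TopologicalSpace Y]
    [ChartedSpace (EuclideanSpace ℝ (Fin n) × EuclideanSpace ℝ (Fin m)) Y]
    (π : Y → X) (k : ℕ) (x : X) : Type _ :=
  Quotient (jetSetoid n m π k x)

/-- The `k`-jet at `x` of a section near `x`. -/
def SectionNear.jet {π : Y → X} {x : X} (φ : SectionNear n m π x) (k : ℕ) : JetAt n m π k x :=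
  Quotient.mk (jetSetoid n m π k x) φ

/-- The coordinate frame `∂/∂x^1, …, ∂/∂x^n` at `x` of a fibered chart. -/
def FiberedChart.frame {π : Y → X} (c : FiberedChart n m π) (x : X) (i : Fin n) :
    TangentSpace (𝓡 n) x :=
  (mfderiv (𝓡 n) (𝓡 n) c.base x).inverse (EuclideanSpace.single i (1 : ℝ))

/-- The range of the coordinates of `k`-jets in a fibered chart. -/
def FiberedChart.jetDomain {π : Y → X} (c : FiberedChart n m π) (k : ℕ) :
    Set (JetCoord n m k) :=
  {p | jetPoint p ∈ c.total.target}

/-- A Lagrangian of order `r`: a smooth fibered morphism `J^r π → Λⁿ T*X` over the identity of `X`.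
Smoothness: in each fibered chart `λ = L ds` with a smooth function `L` of the jet coordinates. -/
structure Lagrangian (n m : ℕ)
    {X : Type*} [TopologicalSpace X] [ChartedSpace (EuclideanSpace ℝ (Fin n)) X]
    {Y : Type*} [TopologicalSpace Y]
    [ChartedSpace (EuclideanSpace ℝ (Fin n) × EuclideanSpace ℝ (Fin m)) Y]
    (π : Y → X) (r : ℕ) where
  toFun : (x : X) → JetAt n m π r x → (TangentSpace (𝓡 n) x) [⋀^Fin n]→ₗ[ℝ] ℝ
  smooth : ∀ c : FiberedChart n m π, ∃ L : JetCoord n m r → ℝ,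
    ContDiffOn ℝ ∞ L (c.jetDomain r) ∧
    ∀ (x : X) (φ : SectionNear n m π x), φ.1 x ∈ c.total.source →
      toFun x (φ.jet r) (c.frame x) = L (c.jetOf r φ.1 x)

/-- The Lagrangian density `L` of `λ = L ds` in a fibered chart, as a function of the jet
coordinates; it is determined on the range of the jet coordinates of the chart. -/
def Lagrangian.density {π : Y → X} {r : ℕ} (lag : Lagrangian n m π r) (c : FiberedChart n m π) :
    JetCoord n m r → ℝ :=
  Classical.choose (lag.smooth c)

/-! ### Vertical vector fields -/

/-- `Ξ` is a smooth `π`-vertical vector field on the open subset `W` of the total space. -/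
structure IsVerticalOn (n m : ℕ)
    {X : Type*} [TopologicalSpace X] [ChartedSpace (EuclideanSpace ℝ (Fin n)) X]
    {Y : Type*} [TopologicalSpace Y]
    [ChartedSpace (EuclideanSpace ℝ (Fin n) × EuclideanSpace ℝ (Fin m)) Y]
    [IsManifold (totalModel n m) ∞ Y]
    (π : Y → X) (W : Set Y) (Ξ : (y : Y) → TangentSpace (totalModel n m) y) : Prop where
  isOpen : IsOpen W
  smooth : ContMDiffOn (totalModel n m) (totalModel n m).tangent ∞
    (fun y => (⟨y, Ξ y⟩ : TangentBundle (totalModel n m) Y)) W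
  vertical : ∀ y ∈ W, mfderiv (totalModel n m) (𝓡 n) π y (Ξ y) = 0

/-- `ν` is a smooth `π`-vertical vector field along the section `γ`, over `U`. -/
structure IsVerticalAlong (n m : ℕ)
    {X : Type*} [TopologicalSpace X] [ChartedSpace (EuclideanSpace ℝ (Fin n)) X]
    {Y : Type*} [TopologicalSpace Y]
    [ChartedSpace (EuclideanSpace ℝ (Fin n) × EuclideanSpace ℝ (Fin m)) Y]
    [IsManifold (totalModel n m) ∞ Y]
    (π : Y → X) (U : Set X) (γ : X → Y)
    (ν : (x : X) → TangentSpace (totalModel n m) (γ x)) : Prop where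
  smooth : ContMDiffOn (𝓡 n) (totalModel n m).tangent ∞
    (fun x => (⟨γ x, ν x⟩ : TangentBundle (totalModel n m) Y)) U
  vertical : ∀ x ∈ U, mfderiv (totalModel n m) (𝓡 n) π (γ x) (ν x) = 0

/-- `Ξ`, given on `W`, extends the vector field `ν` along `γ`, given over `U`. -/
def Extends (U : Set X) (γ : X → Y) (ν : (x : X) → TangentSpace (totalModel n m) (γ x))
    (W : Set Y) (Ξ : (y : Y) → TangentSpace (totalModel n m) y) : Prop :=
  ∀ x ∈ U, γ x ∈ W → Ξ (γ x) = ν x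

/-- The component `Ξ^σ(x, y)` of a vertical vector field in a fibered chart. -/
def FiberedChart.fieldComp {π : Y → X} (c : FiberedChart n m π)
    (Ξ : (y : Y) → TangentSpace (totalModel n m) y) (σ : Fin m)
    (q : EuclideanSpace ℝ (Fin n) × EuclideanSpace ℝ (Fin m)) : ℝ :=
  (show EuclideanSpace ℝ (Fin n) × EuclideanSpace ℝ (Fin m) from
    mfderiv (totalModel n m) (totalModel n m) c.total (c.total.symm q) (Ξ (c.total.symm q))).2 σ

/-! ### Extremals -/

/-- The density `∑ d_JΞ^σ ∂L/∂y^σ_J` of the Lie derivative `L_{J^rΞ} λ` of `λ = L ds` with respect to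
the prolongation `J^rΞ = ∑ d_JΞ^σ ∂/∂y^σ_J` of a vertical vector field `Ξ`. -/
def Lagrangian.lieDensity {π : Y → X} {r : ℕ} (lag : Lagrangian n m π r)
    (c : FiberedChart n m π) (Ξ : (y : Y) → TangentSpace (totalModel n m) y)
    (p : JetCoord n m r) : ℝ :=
  ∑ J : MultiIndex n r, ∑ σ : Fin m,
    totalDerivMulti (k := 0) J.1 (by rw [Nat.zero_add]; exact J.2)
      (fun q => c.fieldComp Ξ σ (jetPoint q)) p * jetPartial J σ (lag.density c) p

/-- The section `γ` over `U` is an extremal of the action of `λ`: the first variation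
`∫_D (L_{J^rΞ} λ) ∘ j^rγ` vanishes for all vertical vector fields `Ξ` such that `Ξ ∘ γ` is supported
in the compact set `D ⊆ U`. The sets `D` with `γ(D)` inside one fibered chart are enough, by
linearity in `Ξ` and a partition of unity; there the integral of an `n`-form `f ds` is the Lebesgue
integral of `f` in the coordinates of the base. -/
def IsExtremal [IsManifold (totalModel n m) ∞ Y] {π : Y → X} {r : ℕ} (lag : Lagrangian n m π r)
    (U : Set X) (γ : X → Y) : Prop :=
  ∀ (c : FiberedChart n m π) (D : Set X), IsCompact D → D ⊆ U →
    (∀ x ∈ D, γ x ∈ c.total.source) →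
    ∀ Ξ : (y : Y) → TangentSpace (totalModel n m) y, IsVerticalOn n m π Set.univ Ξ →
      closure {x | x ∈ U ∧ Ξ (γ x) ≠ 0} ⊆ D →
      ∫ u in c.base '' D, lag.lieDensity c Ξ (c.jetOf r γ (c.base.symm u)) = 0

/-! ### The Jacobi equation -/

/-- The density `∑ Ξ^ρ E_ρ(λ)` of the Lagrangian `Ξ ⌟ E_n(λ)`, of order `2r`. -/
def Lagrangian.contraction {π : Y → X} {r : ℕ} (lag : Lagrangian n m π r)
    (c : FiberedChart n m π) (Ξ : (y : Y) → TangentSpace (totalModel n m) y)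
    (p : JetCoord n m (r + r)) : ℝ :=
  ∑ ρ : Fin m, c.fieldComp Ξ ρ (jetPoint p) * eulerLagrange r (lag.density c) ρ p

/-- The components of the Jacobi morphism `𝒥_Ξ(λ) = E_n(Ξ ⌟ E_n(λ))` in a fibered chart. -/
def Lagrangian.jacobi {π : Y → X} {r : ℕ} (lag : Lagrangian n m π r)
    (c : FiberedChart n m π) (Ξ : (y : Y) → TangentSpace (totalModel n m) y) (σ : Fin m) :
    JetCoord n m (r + r + (r + r)) → ℝ :=
  eulerLagrange (r + r) (lag.contraction c Ξ) σ

/-- The Jacobi equation `𝒥_Ξ(λ) = 0`, for a vertical vector field `Ξ` on `W`, holds along the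
section `γ` over `U` (that is, at the jets of `γ` at all points of `U` which `γ` maps to `W`). -/
def JacobiEqAlong {π : Y → X} {r : ℕ} (lag : Lagrangian n m π r) (U : Set X) (γ : X → Y)
    (W : Set Y) (Ξ : (y : Y) → TangentSpace (totalModel n m) y) : Prop :=
  ∀ x ∈ U, γ x ∈ W → ∀ c : FiberedChart n m π, γ x ∈ c.total.source →
    ∀ σ : Fin m, lag.jacobi c Ξ σ (c.jetOf (r + r + (r + r)) γ x) = 0

/-- A vertical vector field `ν` along `γ` is a Jacobi field along `γ` if near every point of the
image of `γ` it has an extension to a vertical vector field satisfying the Jacobi equation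
along `γ`. -/
def IsJacobiFieldAlong [IsManifold (totalModel n m) ∞ Y] {π : Y → X} {r : ℕ}
    (lag : Lagrangian n m π r) (U : Set X) (γ : X → Y)
    (ν : (x : X) → TangentSpace (totalModel n m) (γ x)) : Prop :=
  ∀ x ∈ U, ∃ (W : Set Y) (Ξ : (y : Y) → TangentSpace (totalModel n m) y),
    γ x ∈ W ∧ IsVerticalOn n m π W Ξ ∧ Extends U γ ν W Ξ ∧ JacobiEqAlong lag U γ W Ξ

end VarJet

end

/-!
The Jacobi morphism is `𝒥_Ξ(λ)_σ = ∑_K (-1)^{|K|} d_K (∂(Ξ^ρ E_ρ)/∂y^σ_K)`. Along a section `γ` a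
total derivative is an ordinary partial derivative, `(d_K F) ∘ jγ = ∂_K (F ∘ jγ)`
(`totalDerivMulti_prolong`, from the chain rule and the symmetry of second derivatives), so
`𝒥_Ξ(λ)` at the jet of `γ` at a point depends only on the functions `∂(Ξ^ρ E_ρ)/∂y^σ_K ∘ jγ` near
that point. By the Leibniz rule each of them is a sum of terms `Ξ^ρ ∂E_ρ/∂y^σ_K`, in which only the
values of `Ξ` along `γ` occur, and terms `∂Ξ^ρ/∂y^σ_K E_ρ`. The latter vanish because `E_ρ ∘ jγ = 0`
along an extremal. This gives `Lagrangian.jacobi_congr`, and with it the independence of the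
Jacobi equation from the extension of a field along `γ`.

That `E_ρ ∘ jγ = 0` (`IsExtremal.eulerLagrange_eq_zero`) is the classical argument. In a fibered
chart the first variation is tested on the fields `g(x) b(y) ∂/∂y^σ`, extended by zero to all of the
total space, where `g` is an arbitrary bump function on a small open set of the base and `b` is a
cutoff in the fibre that equals `1` along `γ` over that set. The first variation is then
`∫ ∑_J ∂_J g (∂L/∂y^σ_J ∘ jγ)`, and integration by parts together with the fundamental lemma of the
calculus of variations (`sum_basePartialMulti_eq_zero_of_weak`) yields the claim.

Local extensions of a vertical field along `γ` exist because in the charts of the submersion `π` is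
linear: the components of the field, as functions on the base, are taken to be constant on the
fibres (`IsVerticalAlong.exists_extends`).
-/

noncomputable section

namespace VarJet

/-! ### Iterated partial derivatives on the base -/

section Base

variable {n : ℕ} {V : Set (EuclideanSpace ℝ (Fin n))} {f g : EuclideanSpace ℝ (Fin n) → ℝ}

theorem contDiffOn_basePartial (hV : IsOpen V) (hf : ContDiffOn ℝ ∞ f V) (i : Fin n) :
    ContDiffOn ℝ ∞ (basePartial i f) V :=
  (hf.fderiv_of_isOpen hV le_rfl).clm_apply contDiffOn_const

theorem contDiffOn_foldr_basePartial (hV : IsOpen V) (hf : ContDiffOn ℝ ∞ f V)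
    (l : List (Fin n)) : ContDiffOn ℝ ∞ (l.foldr basePartial f) V := by
  induction l with
  | nil => exact hf
  | cons i l ih => exact contDiffOn_basePartial hV ih i

theorem contDiffOn_basePartialMulti (hV : IsOpen V) (hf : ContDiffOn ℝ ∞ f V) (J : Fin n → ℕ) :
    ContDiffOn ℝ ∞ (basePartialMulti J f) V :=
  contDiffOn_foldr_basePartial hV hf _

theorem eqOn_basePartial (hV : IsOpen V) (h : Set.EqOn f g V) (i : Fin n) :
    Set.EqOn (basePartial i f) (basePartial i g) V := by
  intro u hu
  simp only [basePartial]
  rw [(h.eventuallyEq_of_mem (hV.mem_nhds hu)).fderiv_eq]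

theorem eqOn_foldr_basePartial (hV : IsOpen V) (h : Set.EqOn f g V) (l : List (Fin n)) :
    Set.EqOn (l.foldr basePartial f) (l.foldr basePartial g) V := by
  induction l with
  | nil => exact h
  | cons i l ih => exact eqOn_basePartial hV ih i

theorem eqOn_basePartialMulti (hV : IsOpen V) (h : Set.EqOn f g V) (J : Fin n → ℕ) :
    Set.EqOn (basePartialMulti J f) (basePartialMulti J g) V :=
  eqOn_foldr_basePartial hV h _

theorem basePartial_comm (hV : IsOpen V) (hf : ContDiffOn ℝ ∞ f V) (i j : Fin n) :
    Set.EqOn (basePartial i (basePartial j f)) (basePartial j (basePartial i f)) V := by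
  intro u hu
  have hfu : ContDiffAt ℝ ∞ f u := hf.contDiffAt (hV.mem_nhds hu)
  have hd : DifferentiableAt ℝ (fderiv ℝ f) u :=
    (hfu.fderiv_right (m := 1) (by norm_cast)).differentiableAt one_ne_zero
  have hs : IsSymmSndFDerivAt ℝ f u :=
    hfu.isSymmSndFDerivAt (by rw [minSmoothness_of_isRCLikeNormedField]; norm_cast)
  have key : ∀ a b : EuclideanSpace ℝ (Fin n),
      fderiv ℝ (fun v => fderiv ℝ f v b) u a = fderiv ℝ (fderiv ℝ f) u a b := by
    intro a b
    rw [fderiv_clm_apply hd (differentiableAt_const b)]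
    simp
  exact (key _ _).trans ((hs.eq _ _).trans (key _ _).symm)

/-- Iterated partial derivatives of a smooth function do not depend on the order of the indices. -/
theorem foldr_basePartial_perm (hV : IsOpen V) (hf : ContDiffOn ℝ ∞ f V) {l l' : List (Fin n)}
    (h : l.Perm l') : Set.EqOn (l.foldr basePartial f) (l'.foldr basePartial f) V := by
  induction h with
  | nil => exact fun _ _ => rfl
  | cons i _ ih => exact eqOn_basePartial hV ih i
  | swap i j l => exact basePartial_comm hV (contDiffOn_foldr_basePartial hV hf l) _ _
  | trans _ _ h₁ h₂ => exact h₁.trans h₂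

theorem count_indexList (J : Fin n → ℕ) (a : Fin n) : (indexList J).count a = J a := by
  simp [indexList, List.count_flatMap, List.count_replicate, Function.comp_def, ← Fin.sum_univ_def]

theorem indexList_add_single_perm (J : Fin n → ℕ) (i : Fin n) :
    (indexList (J + Pi.single i 1)).Perm (i :: indexList J) := by
  rw [List.perm_iff_count]
  intro a
  rw [List.count_cons, count_indexList, count_indexList, Pi.add_apply]
  by_cases h : a = i
  · subst h; simp
  · simp [h, Ne.symm h]

theorem basePartial_basePartialMulti (hV : IsOpen V) (hf : ContDiffOn ℝ ∞ f V) (J : Fin n → ℕ)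
    (i : Fin n) :
    Set.EqOn (basePartial i (basePartialMulti J f)) (basePartialMulti (J + Pi.single i 1) f) V :=
  (foldr_basePartial_perm hV hf (indexList_add_single_perm J i)).symm

@[simp] theorem basePartialMulti_zero (f : EuclideanSpace ℝ (Fin n) → ℝ) :
    basePartialMulti 0 f = f := by
  have h : indexList (0 : Fin n → ℕ) = [] := List.length_eq_zero_iff.1 (by simp [length_indexList])
  rw [basePartialMulti, h, List.foldr_nil]

end Base

/-! ### Total derivatives along prolonged sections -/

section Prolongation

variable {n m : ℕ}

/-- The coordinate expression of the `k`-jet prolongation `u ↦ (u, ∂^{|J|} φ^σ/∂x^J (u))` of the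
section with components `φ^σ`. -/
def prolong (k : ℕ) (φ : Fin m → EuclideanSpace ℝ (Fin n) → ℝ) (u : EuclideanSpace ℝ (Fin n)) :
    JetCoord n m k :=
  (u, fun J => WithLp.toLp 2 fun σ => basePartialMulti J.1 (φ σ) u)

variable {V : Set (EuclideanSpace ℝ (Fin n))} {φ : Fin m → EuclideanSpace ℝ (Fin n) → ℝ}

theorem jetPoint_prolong (k : ℕ) (u : EuclideanSpace ℝ (Fin n)) :
    jetPoint (prolong k φ u) = (u, WithLp.toLp 2 fun σ => φ σ u) := by
  simp [jetPoint, prolong, MultiIndex.zero]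

theorem contDiff_jetProj {k l : ℕ} (h : k ≤ l) :
    ContDiff ℝ ∞ (jetProj (n := n) (m := m) h) := by
  refine contDiff_fst.prodMk (contDiff_pi.2 fun J => ?_)
  exact (contDiff_apply (𝕜 := ℝ) (n := ∞) (E := EuclideanSpace ℝ (Fin m))
    (⟨J.1, J.2.trans h⟩ : MultiIndex n l)).comp contDiff_snd

theorem contDiff_jetPoint {k : ℕ} : ContDiff ℝ ∞ (jetPoint (n := n) (m := m) (k := k)) :=
  contDiff_fst.prodMk ((contDiff_apply (𝕜 := ℝ) (n := ∞) (E := EuclideanSpace ℝ (Fin m))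
    (MultiIndex.zero n k)).comp contDiff_snd)

/-- The derivative of the `k`-jet prolongation reads off the `(k + 1)`-jet; this is where the
symmetry of the second derivatives enters. -/
theorem fderiv_prolong_single (hV : IsOpen V) (hφ : ∀ σ, ContDiffOn ℝ ∞ (φ σ) V) (k : ℕ)
    {u : EuclideanSpace ℝ (Fin n)} (hu : u ∈ V) (i : Fin n) :
    fderiv ℝ (prolong k φ) u (EuclideanSpace.single i 1) =
      (EuclideanSpace.single i 1, fun J => (prolong (k + 1) φ u).2 (J.append i)) := by
  have hc : ∀ (J : MultiIndex n k) (σ : Fin m), HasFDerivAt (basePartialMulti J.1 (φ σ))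
      (fderiv ℝ (basePartialMulti J.1 (φ σ)) u) u := fun J σ =>
    (((contDiffOn_basePartialMulti hV (hφ σ) J.1).contDiffAt (hV.mem_nhds hu)).differentiableAt
      (by simp)).hasFDerivAt
  have hE : ∀ J : MultiIndex n k, HasFDerivAt
      (fun v => WithLp.toLp 2 fun σ => basePartialMulti J.1 (φ σ) v)
      ((PiLp.continuousLinearEquiv 2 ℝ (fun _ : Fin m => ℝ)).symm.toContinuousLinearMap.comp
        (ContinuousLinearMap.pi fun σ => fderiv ℝ (basePartialMulti J.1 (φ σ)) u)) u := fun J =>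
    (PiLp.continuousLinearEquiv 2 ℝ
      (fun _ : Fin m => ℝ)).symm.toContinuousLinearMap.hasFDerivAt.comp u
        (hasFDerivAt_pi.2 fun σ => hc J σ)
  have H : HasFDerivAt (prolong k φ) _ u := (hasFDerivAt_id u).prodMk (hasFDerivAt_pi.2 hE)
  rw [H.fderiv]
  refine Prod.ext rfl (funext fun J => ?_)
  ext σ
  exact basePartial_basePartialMulti hV (hφ σ) J.1 i hu

theorem contDiffOn_prolong (hV : IsOpen V) (hφ : ∀ σ, ContDiffOn ℝ ∞ (φ σ) V) (k : ℕ) :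
    ContDiffOn ℝ ∞ (prolong k φ) V :=
  contDiffOn_id.prodMk (contDiffOn_pi.2 fun J => contDiffOn_euclidean.2 fun σ =>
    contDiffOn_basePartialMulti hV (hφ σ) J.1)

/-- The chain rule along a prolonged section: `(d_i F) ∘ j^{k+1}φ = ∂(F ∘ j^kφ)/∂x^i`. -/
theorem totalDeriv_prolong (hV : IsOpen V) (hφ : ∀ σ, ContDiffOn ℝ ∞ (φ σ) V) {k : ℕ}
    {F : JetCoord n m k → ℝ} {u : EuclideanSpace ℝ (Fin n)} (hu : u ∈ V)
    (hF : DifferentiableAt ℝ F (prolong k φ u)) (i : Fin n) :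
    totalDeriv i F (prolong (k + 1) φ u) = basePartial i (F ∘ prolong k φ) u := by
  have h : DifferentiableAt ℝ (prolong k φ) u :=
    ((contDiffOn_prolong hV hφ k).contDiffAt (hV.mem_nhds hu)).differentiableAt (by simp)
  rw [basePartial, fderiv_comp u hF h, ContinuousLinearMap.comp_apply,
    fderiv_prolong_single hV hφ k hu]
  rfl

variable {k : ℕ} {Ω : Set (JetCoord n m k)} {F : JetCoord n m k → ℝ}

theorem isOpen_preimage_jetProj (hΩ : IsOpen Ω) {l : ℕ} (h : k ≤ l) :
    IsOpen (jetProj h ⁻¹' Ω) :=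
  hΩ.preimage (contDiff_jetProj h).continuous

theorem contDiffOn_totalDeriv (hΩ : IsOpen Ω) (hF : ContDiffOn ℝ ∞ F Ω) (i : Fin n) :
    ContDiffOn ℝ ∞ (totalDeriv i F) (jetProj (Nat.le_succ k) ⁻¹' Ω) := by
  have h₁ : ContDiffOn ℝ ∞ (fun p : JetCoord n m (k + 1) => fderiv ℝ F (jetProj (Nat.le_succ k) p))
      (jetProj (Nat.le_succ k) ⁻¹' Ω) :=
    (hF.fderiv_of_isOpen hΩ le_rfl).comp (contDiff_jetProj _).contDiffOn (Set.mapsTo_preimage _ _)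
  have h₂ : ContDiff ℝ ∞ (fun p : JetCoord n m (k + 1) =>
      ((EuclideanSpace.single i 1, fun J => p.2 (J.append i)) : JetCoord n m k)) :=
    contDiff_const.prodMk (contDiff_pi.2 fun J =>
      (contDiff_apply (𝕜 := ℝ) (n := ∞) (E := EuclideanSpace ℝ (Fin m)) (J.append i)).comp
        contDiff_snd)
  exact h₁.clm_apply h₂.contDiffOn

theorem contDiffOn_iterTotalDeriv (hΩ : IsOpen Ω) (hF : ContDiffOn ℝ ∞ F Ω) (l : List (Fin n)) :
    ContDiffOn ℝ ∞ (iterTotalDeriv l F) (jetProj (Nat.le_add_right k l.length) ⁻¹' Ω) := by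
  induction l with
  | nil => exact hF
  | cons i l ih => exact contDiffOn_totalDeriv (isOpen_preimage_jetProj hΩ _) ih i

theorem contDiffOn_totalDerivMulti (hΩ : IsOpen Ω) (hF : ContDiffOn ℝ ∞ F Ω) {s : ℕ}
    (J : Fin n → ℕ) (h : k + ∑ i, J i ≤ s) :
    ContDiffOn ℝ ∞ (totalDerivMulti J h F) (jetProj ((Nat.le_add_right _ _).trans h) ⁻¹' Ω) :=
  (contDiffOn_iterTotalDeriv hΩ hF (indexList J)).comp (contDiff_jetProj _).contDiffOn
    fun _ hp => hp

theorem iterTotalDeriv_prolong (hV : IsOpen V) (hφ : ∀ σ, ContDiffOn ℝ ∞ (φ σ) V)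
    (hΩ : IsOpen Ω) (hF : ContDiffOn ℝ ∞ F Ω) (hVΩ : Set.MapsTo (prolong k φ) V Ω)
    (l : List (Fin n)) :
    Set.EqOn (iterTotalDeriv l F ∘ prolong (k + l.length) φ)
      (l.foldr basePartial (F ∘ prolong k φ)) V := by
  induction l with
  | nil => exact fun _ _ => rfl
  | cons i l ih =>
    intro u hu
    refine Eq.trans ?_ (eqOn_basePartial hV ih i hu)
    refine totalDeriv_prolong hV hφ hu ?_ i
    exact ((contDiffOn_iterTotalDeriv hΩ hF l).contDiffAt
      ((isOpen_preimage_jetProj hΩ _).mem_nhds (hVΩ hu))).differentiableAt (by simp)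

/-- Along a prolonged section, the total derivative `d_J` is the ordinary partial derivative. -/
theorem totalDerivMulti_prolong (hV : IsOpen V) (hφ : ∀ σ, ContDiffOn ℝ ∞ (φ σ) V)
    (hΩ : IsOpen Ω) (hF : ContDiffOn ℝ ∞ F Ω) (hVΩ : Set.MapsTo (prolong k φ) V Ω)
    {s : ℕ} (J : Fin n → ℕ) (h : k + ∑ i, J i ≤ s) {u : EuclideanSpace ℝ (Fin n)} (hu : u ∈ V) :
    totalDerivMulti J h F (prolong s φ u) = basePartialMulti J (F ∘ prolong k φ) u :=
  iterTotalDeriv_prolong hV hφ hΩ hF hVΩ (indexList J) hu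

theorem contDiffOn_jetPartial (hΩ : IsOpen Ω) (hF : ContDiffOn ℝ ∞ F Ω) (J : MultiIndex n k)
    (σ : Fin m) : ContDiffOn ℝ ∞ (jetPartial J σ F) Ω :=
  (hF.fderiv_of_isOpen hΩ le_rfl).clm_apply contDiffOn_const

theorem contDiffOn_eulerLagrange (hΩ : IsOpen Ω) (hF : ContDiffOn ℝ ∞ F Ω) (σ : Fin m) :
    ContDiffOn ℝ ∞ (eulerLagrange k F σ) (jetProj (Nat.le_add_right k k) ⁻¹' Ω) :=
  ContDiffOn.sum fun J _ => contDiffOn_const.mul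
    ((contDiffOn_totalDerivMulti hΩ (contDiffOn_jetPartial hΩ hF J σ) J.1 _).mono fun _ hp => hp)

/-- Along a section the Euler--Lagrange expressions are those of elementary calculus of variations,
with partial instead of total derivatives. -/
theorem eulerLagrange_prolong (hV : IsOpen V) (hφ : ∀ σ, ContDiffOn ℝ ∞ (φ σ) V)
    (hΩ : IsOpen Ω) (hF : ContDiffOn ℝ ∞ F Ω) (hVΩ : Set.MapsTo (prolong k φ) V Ω)
    (σ : Fin m) {u : EuclideanSpace ℝ (Fin n)} (hu : u ∈ V) :
    eulerLagrange k F σ (prolong (k + k) φ u) = ∑ J : MultiIndex n k, (-1 : ℝ) ^ (∑ i, J.1 i) *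
      basePartialMulti J.1 (jetPartial J σ F ∘ prolong k φ) u :=
  Finset.sum_congr rfl fun J _ => by
    rw [totalDerivMulti_prolong hV hφ hΩ (contDiffOn_jetPartial hΩ hF J σ) hVΩ J.1 _ hu]

end Prolongation

/-! ### Integration by parts and the fundamental lemma of the calculus of variations -/

section Variations

variable {n : ℕ} {V : Set (EuclideanSpace ℝ (Fin n))} {g P : EuclideanSpace ℝ (Fin n) → ℝ}

theorem contDiff_foldr_basePartial (hg : ContDiff ℝ ∞ g) (l : List (Fin n)) :
    ContDiff ℝ ∞ (l.foldr basePartial g) :=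
  contDiffOn_univ.1 (contDiffOn_foldr_basePartial isOpen_univ hg.contDiffOn l)

theorem tsupport_foldr_basePartial_subset (g : EuclideanSpace ℝ (Fin n) → ℝ) (l : List (Fin n)) :
    tsupport (l.foldr basePartial g) ⊆ tsupport g := by
  induction l with
  | nil => exact subset_rfl
  | cons i l ih => exact (tsupport_fderiv_apply_subset ℝ _).trans ih

theorem integrable_mul_of_tsupport_subset (hV : IsOpen V) (hg : Continuous g)
    (hc : HasCompactSupport g) (hgV : tsupport g ⊆ V) (hP : ContinuousOn P V) :
    Integrable (fun u => g u * P u) := by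
  refine Continuous.integrable_of_hasCompactSupport ?_ hc.mul_right
  exact (hg.continuousOn.mul hP).continuous_of_tsupport_subset hV
    ((tsupport_mul_subset_left (f := g) (g := P)).trans hgV)

theorem integral_basePartial_mul (hV : IsOpen V) (hg : ContDiff ℝ ∞ g)
    (hc : HasCompactSupport g) (hgV : tsupport g ⊆ V) (hP : ContDiffOn ℝ ∞ P V) (i : Fin n) :
    ∫ u, basePartial i g u * P u = -∫ u, g u * basePartial i P u := by
  have hs : tsupport (basePartial i g) ⊆ tsupport g := tsupport_fderiv_apply_subset ℝ _
  have h := integral_mul_fderiv_eq_neg_fderiv_mul_of_integrable (μ := volume) (f := g) (g := P)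
    (v := EuclideanSpace.single i 1)
    (integrable_mul_of_tsupport_subset hV (contDiff_foldr_basePartial hg [i]).continuous
      (hc.mono' (subset_tsupport _ |>.trans hs)) (hs.trans hgV) hP.continuousOn)
    (integrable_mul_of_tsupport_subset hV hg.continuous hc hgV
      (contDiffOn_basePartial hV hP i).continuousOn)
    (integrable_mul_of_tsupport_subset hV hg.continuous hc hgV hP.continuousOn)
    (fun u _ => hg.contDiffAt.differentiableAt (by simp))
    (fun u hu => (hP.contDiffAt (hV.mem_nhds (hgV hu))).differentiableAt (by simp))
  exact (neg_eq_iff_eq_neg.2 h).symm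

theorem integral_foldr_basePartial_mul (hV : IsOpen V) (hg : ContDiff ℝ ∞ g)
    (hc : HasCompactSupport g) (hgV : tsupport g ⊆ V) (hP : ContDiffOn ℝ ∞ P V)
    (l : List (Fin n)) :
    ∫ u, l.foldr basePartial g u * P u =
      (-1) ^ l.length * ∫ u, g u * l.reverse.foldr basePartial P u := by
  induction l generalizing P with
  | nil => simp
  | cons i l ih =>
    have hs := tsupport_foldr_basePartial_subset g l
    rw [List.foldr_cons, integral_basePartial_mul hV (contDiff_foldr_basePartial hg l)
      (hc.mono' (subset_tsupport _ |>.trans hs)) (hs.trans hgV) hP i,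
      ih (contDiffOn_basePartial hV hP i)]
    simp only [List.length_cons, List.reverse_cons, List.foldr_append, List.foldr_nil,
      List.foldr_cons]
    ring

theorem integral_basePartialMulti_mul (hV : IsOpen V) (hg : ContDiff ℝ ∞ g)
    (hc : HasCompactSupport g) (hgV : tsupport g ⊆ V) (hP : ContDiffOn ℝ ∞ P V)
    (J : Fin n → ℕ) :
    ∫ u, basePartialMulti J g u * P u =
      (-1) ^ (∑ i, J i) * ∫ u, g u * basePartialMulti J P u := by
  rw [basePartialMulti, integral_foldr_basePartial_mul hV hg hc hgV hP, length_indexList]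
  congr 2
  funext u
  -- off `V`, where partial derivatives of `P` need not commute, `g` vanishes
  by_cases hu : u ∈ V
  · rw [foldr_basePartial_perm hV hP (List.reverse_perm (indexList J)) hu]; rfl
  · rw [image_eq_zero_of_notMem_tsupport fun h => hu (hgV h), zero_mul, zero_mul]

/-- The weak form of an Euler--Lagrange equation, tested against smooth functions supported in an
open set, implies the strong form there. -/
theorem sum_basePartialMulti_eq_zero_of_weak {k : ℕ} (hV : IsOpen V)
    {P : MultiIndex n k → EuclideanSpace ℝ (Fin n) → ℝ} (hP : ∀ J, ContDiffOn ℝ ∞ (P J) V)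
    (h : ∀ g : EuclideanSpace ℝ (Fin n) → ℝ, ContDiff ℝ ∞ g → HasCompactSupport g →
      tsupport g ⊆ V → ∫ u, ∑ J, basePartialMulti J.1 g u * P J u = 0) :
    ∀ u ∈ V, ∑ J, (-1 : ℝ) ^ (∑ i, J.1 i) * basePartialMulti J.1 (P J) u = 0 := by
  have hcont : ContinuousOn
      (fun u => ∑ J, (-1 : ℝ) ^ (∑ i, J.1 i) * basePartialMulti J.1 (P J) u) V :=
    continuousOn_finsetSum _ fun J _ => continuousOn_const.mul
      (contDiffOn_basePartialMulti hV (hP J) J.1).continuousOn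
  have hae := hV.ae_eq_zero_of_integral_contDiff_smul_eq_zero (μ := volume)
    (hcont.locallyIntegrableOn hV.measurableSet) fun g hg hc hgV => by
      have h₁ : ∀ J : MultiIndex n k, Integrable (fun u => basePartialMulti J.1 g u * P J u) :=
        fun J => by
          have hs := tsupport_foldr_basePartial_subset g (indexList J.1)
          exact integrable_mul_of_tsupport_subset hV (contDiff_foldr_basePartial hg _).continuous
            (hc.mono' (subset_tsupport _ |>.trans hs)) (hs.trans hgV) (hP J).continuousOn
      have h₂ : ∀ J : MultiIndex n k, Integrable
          (fun u => (-1 : ℝ) ^ (∑ i, J.1 i) * (g u * basePartialMulti J.1 (P J) u)) := fun J =>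
        (integrable_mul_of_tsupport_subset hV hg.continuous hc hgV
          (contDiffOn_basePartialMulti hV (hP J) J.1).continuousOn).const_mul _
      have h₀ := h g hg hc hgV
      rw [integral_finsetSum _ fun J _ => h₁ J] at h₀
      simp only [smul_eq_mul, Finset.mul_sum, mul_left_comm (g _)]
      rw [integral_finsetSum _ fun J _ => h₂ J, ← h₀]
      exact Finset.sum_congr rfl fun J _ => by
        rw [integral_const_mul, integral_basePartialMulti_mul hV hg hc hgV (hP J)]
  exact Measure.eqOn_open_of_ae_eq (g := fun _ => (0 : ℝ))
    ((ae_restrict_iff' hV.measurableSet).2 hae) hV hcont continuousOn_const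

end Variations

/-! ### Vector fields in a chart -/

section ChartFields

variable {E : Type*} [NormedAddCommGroup E] [NormedSpace ℝ E]
  {M : Type*} [TopologicalSpace M] [ChartedSpace E M]
  {e : OpenPartialHomeomorph M E}

theorem mdifferentiable_of_mem_maximalAtlas
    (he : e ∈ IsManifold.maximalAtlas 𝓘(ℝ, E) ∞ M) : e.MDifferentiable 𝓘(ℝ, E) 𝓘(ℝ, E) :=
  ⟨(contMDiffOn_of_mem_maximalAtlas he).mdifferentiableOn (by simp),
    (contMDiffOn_symm_of_mem_maximalAtlas he).mdifferentiableOn (by simp)⟩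

theorem mfderiv_symm_mfderiv (he : e ∈ IsManifold.maximalAtlas 𝓘(ℝ, E) ∞ M) {y : M}
    (hy : y ∈ e.source) (v : TangentSpace 𝓘(ℝ, E) y) :
    mfderiv 𝓘(ℝ, E) 𝓘(ℝ, E) e.symm (e y) (mfderiv 𝓘(ℝ, E) 𝓘(ℝ, E) e y v) = v :=
  DFunLike.congr_fun ((mdifferentiable_of_mem_maximalAtlas he).symm_comp_deriv hy) v

theorem mfderiv_mfderiv_symm (he : e ∈ IsManifold.maximalAtlas 𝓘(ℝ, E) ∞ M) {y : M}
    (hy : y ∈ e.source) (v : E) :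
    mfderiv 𝓘(ℝ, E) 𝓘(ℝ, E) e y (mfderiv 𝓘(ℝ, E) 𝓘(ℝ, E) e.symm (e y) v) = v := by
  have h := DFunLike.congr_fun
    ((mdifferentiable_of_mem_maximalAtlas he).comp_symm_deriv (e.map_source hy)) v
  rw [e.left_inv hy] at h
  exact h

/-- The vector field on the domain of a chart with prescribed components in that chart. -/
def chartField (e : OpenPartialHomeomorph M E) (w : E → E) (y : M) : TangentSpace 𝓘(ℝ, E) y :=
  show E from mfderiv 𝓘(ℝ, E) 𝓘(ℝ, E) e.symm (e y) (w (e y))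

theorem mfderiv_chartField (he : e ∈ IsManifold.maximalAtlas 𝓘(ℝ, E) ∞ M) (w : E → E) {y : M}
    (hy : y ∈ e.source) : mfderiv 𝓘(ℝ, E) 𝓘(ℝ, E) e y (chartField e w y) = w (e y) :=
  mfderiv_mfderiv_symm he hy _

variable [IsManifold 𝓘(ℝ, E) ∞ M]

/-- The components in a chart of a smooth family of tangent vectors are smooth. -/
theorem contMDiffAt_mfderiv_chart (he : e ∈ IsManifold.maximalAtlas 𝓘(ℝ, E) ∞ M)
    {E' : Type*} [NormedAddCommGroup E'] [NormedSpace ℝ E']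
    {N : Type*} [TopologicalSpace N] [ChartedSpace E' N]
    {f : N → M} {v : (x : N) → TangentSpace 𝓘(ℝ, E) (f x)} {x : N}
    (hs : ContMDiffAt 𝓘(ℝ, E') 𝓘(ℝ, E).tangent ∞
      (fun x => (⟨f x, v x⟩ : TangentBundle 𝓘(ℝ, E) M)) x)
    (hx : f x ∈ e.source) :
    ContMDiffAt 𝓘(ℝ, E') 𝓘(ℝ, E) ∞
      (fun x => (mfderiv 𝓘(ℝ, E) 𝓘(ℝ, E) e (f x) (v x) : E)) x := by
  have hT := (contMDiffOn_of_mem_maximalAtlas he).contMDiffOn_tangentMapWithin (m := ∞) le_rfl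
    e.open_source.uniqueMDiffOn
  have hopen : IsOpen (Bundle.TotalSpace.proj ⁻¹' e.source :
      Set (TangentBundle 𝓘(ℝ, E) M)) :=
    e.open_source.preimage (FiberBundle.continuous_proj E _)
  have hTs := (hT.contMDiffAt (x := (⟨f x, v x⟩ : TangentBundle 𝓘(ℝ, E) M))
    (hopen.mem_nhds hx)).comp x hs
  have h2 := ((contMDiff_snd_tangentBundle_modelSpace E 𝓘(ℝ, E) (n := ∞)).contMDiffAt).comp x hTs
  refine h2.congr_of_eventuallyEq ?_
  have hc : ContinuousAt f x := (FiberBundle.continuous_proj E _).continuousAt.comp hs.continuousAt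
  filter_upwards [hc.preimage_mem_nhds (e.open_source.mem_nhds hx)] with z hz
  have h : mfderivWithin 𝓘(ℝ, E) 𝓘(ℝ, E) e e.source (f z) = mfderiv 𝓘(ℝ, E) 𝓘(ℝ, E) e (f z) :=
    mfderivWithin_of_isOpen e.open_source hz
  exact (DFunLike.congr_fun h (v z)).symm

theorem contMDiffAt_chartField (he : e ∈ IsManifold.maximalAtlas 𝓘(ℝ, E) ∞ M) {w : E → E} {y : M}
    (hy : y ∈ e.source) (hw : ContDiffAt ℝ ∞ w (e y)) :
    ContMDiffAt 𝓘(ℝ, E) 𝓘(ℝ, E).tangent ∞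
      (fun y => (⟨y, chartField e w y⟩ : TangentBundle 𝓘(ℝ, E) M)) y := by
  have hT := (contMDiffOn_symm_of_mem_maximalAtlas he).contMDiffOn_tangentMapWithin (m := ∞) le_rfl
    e.open_target.uniqueMDiffOn
  have hopen : IsOpen (Bundle.TotalSpace.proj ⁻¹' e.target :
      Set (TangentBundle 𝓘(ℝ, E) E)) :=
    e.open_target.preimage (FiberBundle.continuous_proj E _)
  have hw' : ContMDiffAt 𝓘(ℝ, E) 𝓘(ℝ, E).tangent ∞
      (fun q => (⟨q, w q⟩ : TangentBundle 𝓘(ℝ, E) E)) (e y) :=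
    contMDiffAt_vectorSpace_iff_contDiffAt.2 hw
  have h1 := hw'.comp y (contMDiffAt_of_mem_maximalAtlas he hy)
  have h2 := (hT.contMDiffAt (x := (⟨e y, w (e y)⟩ : TangentBundle 𝓘(ℝ, E) E))
    (hopen.mem_nhds (e.map_source hy))).comp y h1
  refine h2.congr_of_eventuallyEq ?_
  filter_upwards [e.open_source.mem_nhds hy] with z hz
  simp only [Function.comp_apply, tangentMapWithin, chartField]
  rw [mfderivWithin_of_isOpen e.open_target (e.map_source hz)]
  refine Bundle.TotalSpace.ext (e.left_inv hz).symm ?_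
  exact HEq.rfl

end ChartFields

/-! ### Vertical vectors and sections in adapted charts -/

section Fibered

variable {n m : ℕ}
  {X : Type*} [TopologicalSpace X] [ChartedSpace (EuclideanSpace ℝ (Fin n)) X]
  {Y : Type*} [TopologicalSpace Y]
  [ChartedSpace (EuclideanSpace ℝ (Fin n) × EuclideanSpace ℝ (Fin m)) Y]
  {π : Y → X}

/-- In charts in which `π` is linear, vertical vectors are those whose components lie in the kernel
of that linear map. -/
theorem mfderiv_eq_zero_iff_of_chart
    {e : OpenPartialHomeomorph Y (EuclideanSpace ℝ (Fin n) × EuclideanSpace ℝ (Fin m))}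
    {b : OpenPartialHomeomorph X (EuclideanSpace ℝ (Fin n))}
    (he : e ∈ IsManifold.maximalAtlas (totalModel n m) ∞ Y)
    (hb : b ∈ IsManifold.maximalAtlas (𝓡 n) ∞ X)
    (A : EuclideanSpace ℝ (Fin n) × EuclideanSpace ℝ (Fin m) →L[ℝ] EuclideanSpace ℝ (Fin n))
    (hmaps : Set.MapsTo π e.source b.source) (hA : ∀ y ∈ e.source, b (π y) = A (e y))
    {y : Y} (hy : y ∈ e.source) (v : TangentSpace (totalModel n m) y) :
    mfderiv (totalModel n m) (𝓡 n) π y v = 0 ↔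
      A (mfderiv (totalModel n m) (totalModel n m) e y v) = 0 := by
  have hbm := mdifferentiable_of_mem_maximalAtlas hb
  have hev : π =ᶠ[𝓝 y] b.symm ∘ A ∘ e := by
    filter_upwards [e.open_source.mem_nhds hy] with z hz
    simp only [Function.comp_apply]
    rw [← hA z hz, b.left_inv (hmaps hz)]
  have hmem : A (e y) ∈ b.target := by rw [← hA y hy]; exact b.map_source (hmaps hy)
  have h₁ := ((mdifferentiable_of_mem_maximalAtlas he).mdifferentiableAt hy).hasMFDerivAt
  have h₂ : HasMFDerivAt (totalModel n m) (𝓡 n) A (e y) A := A.hasMFDerivAt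
  have h₃ := (hbm.mdifferentiableAt_symm hmem).hasMFDerivAt
  have h := (h₃.comp y (h₂.comp y h₁)).congr_of_eventuallyEq hev
  rw [h.mfderiv]
  exact map_eq_zero_iff _ (hbm.symm.mfderiv_injective hmem)

namespace FiberedChart

variable (c : FiberedChart n m π)

theorem isOpen_jetDomain (k : ℕ) : IsOpen (c.jetDomain k) :=
  c.total.open_target.preimage contDiff_jetPoint.continuous

theorem jetOf_eq_prolong (k : ℕ) (φ : X → Y) (x : X) :
    c.jetOf k φ x = prolong k (c.sectionComp φ) (c.base x) := rfl

theorem mfderiv_eq_zero_iff {y : Y} (hy : y ∈ c.total.source)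
    (v : TangentSpace (totalModel n m) y) :
    mfderiv (totalModel n m) (𝓡 n) π y v = 0 ↔
      (show EuclideanSpace ℝ (Fin n) × EuclideanSpace ℝ (Fin m) from
        mfderiv (totalModel n m) (totalModel n m) c.total y v).1 = 0 :=
  mfderiv_eq_zero_iff_of_chart c.total_mem c.base_mem (ContinuousLinearMap.fst ℝ _ _) c.mapsTo
    c.base_proj hy v

/-- The components of a smooth vector field are smooth. -/
theorem contDiffOn_fieldComp [IsManifold (totalModel n m) ∞ Y] {W : Set Y}
    {Ξ : (y : Y) → TangentSpace (totalModel n m) y} (hW : IsOpen W)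
    (hΞ : ContMDiffOn (totalModel n m) (totalModel n m).tangent ∞
      (fun y => (⟨y, Ξ y⟩ : TangentBundle (totalModel n m) Y)) W) (σ : Fin m) :
    ContDiffOn ℝ ∞ (c.fieldComp Ξ σ) (c.total.target ∩ c.total.symm ⁻¹' W) := by
  rintro q ⟨hq, hqW⟩
  have h₁ := (hΞ.contMDiffAt (hW.mem_nhds hqW)).comp q
    (contMDiffAt_symm_of_mem_maximalAtlas c.total_mem hq)
  have h₂ := (contMDiffAt_mfderiv_chart c.total_mem (f := c.total.symm)
    (v := fun q => Ξ (c.total.symm q)) h₁ (c.total.map_target hq)).contDiffAt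
  exact ((contDiffAt_euclidean.1 h₂.snd) σ).contDiffWithinAt

/-- The part of the range of a fibered chart's base chart over which the section `γ` over `U` has
values in the domain of the chart. -/
def sectionDomain (U : Set X) (γ : X → Y) : Set (EuclideanSpace ℝ (Fin n)) :=
  c.base.target ∩ c.base.symm ⁻¹' (U ∩ γ ⁻¹' c.total.source)

variable {c} {U : Set X} {γ : X → Y}

theorem isOpen_sectionDomain (hγ : IsLocalSection n m π U γ) : IsOpen (c.sectionDomain U γ) :=
  c.base.isOpen_inter_preimage_symm
    (hγ.smooth.continuousOn.isOpen_inter_preimage hγ.isOpen c.total.open_source)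

theorem base_mem_sectionDomain (hγ : IsLocalSection n m π U γ) {x : X} (hx : x ∈ U)
    (hxc : γ x ∈ c.total.source) : c.base x ∈ c.sectionDomain U γ := by
  have hxb : x ∈ c.base.source := hγ.section_eq x hx ▸ c.mapsTo hxc
  refine ⟨c.base.map_source hxb, ?_⟩
  rw [Set.mem_preimage, c.base.left_inv hxb]
  exact ⟨hx, hxc⟩

theorem contDiffOn_sectionComp (hγ : IsLocalSection n m π U γ) (σ : Fin m) :
    ContDiffOn ℝ ∞ (c.sectionComp γ σ) (c.sectionDomain U γ) := by
  rintro u ⟨hu, huU, huc⟩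
  have h₁ := (hγ.smooth.contMDiffAt (hγ.isOpen.mem_nhds huU)).comp u
    (contMDiffAt_symm_of_mem_maximalAtlas c.base_mem hu)
  have h₂ := ((contMDiffAt_of_mem_maximalAtlas c.total_mem huc).comp u h₁).contDiffAt
  exact ((contDiffAt_euclidean.1 h₂.snd) σ).contDiffWithinAt

theorem jetPoint_prolong_sectionComp (hγ : IsLocalSection n m π U γ) (k : ℕ)
    {u : EuclideanSpace ℝ (Fin n)} (hu : u ∈ c.sectionDomain U γ) :
    jetPoint (prolong k (c.sectionComp γ) u) = c.total (γ (c.base.symm u)) := by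
  rw [jetPoint_prolong]
  refine Prod.ext ?_ rfl
  rw [← c.base_proj _ hu.2.2, hγ.section_eq _ hu.2.1, c.base.right_inv hu.1]

theorem mapsTo_prolong_sectionComp (hγ : IsLocalSection n m π U γ) (k : ℕ) :
    Set.MapsTo (prolong k (c.sectionComp γ)) (c.sectionDomain U γ) (c.jetDomain k) := by
  intro u hu
  change jetPoint _ ∈ c.total.target
  rw [jetPoint_prolong_sectionComp hγ k hu]
  exact c.total.map_source hu.2.2

theorem fieldComp_jetPoint_prolong (hγ : IsLocalSection n m π U γ) (k : ℕ)
    {u : EuclideanSpace ℝ (Fin n)} (hu : u ∈ c.sectionDomain U γ)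
    {Ξ₁ Ξ₂ : (y : Y) → TangentSpace (totalModel n m) y}
    (h : Ξ₁ (γ (c.base.symm u)) = Ξ₂ (γ (c.base.symm u))) (σ : Fin m) :
    c.fieldComp Ξ₁ σ (jetPoint (prolong k (c.sectionComp γ) u)) =
      c.fieldComp Ξ₂ σ (jetPoint (prolong k (c.sectionComp γ) u)) := by
  rw [jetPoint_prolong_sectionComp hγ k hu, fieldComp, fieldComp, c.total.left_inv hu.2.2, h]

end FiberedChart

/-! ### Extremals satisfy the Euler–Lagrange equations -/

/-- The vector field `f ∂/∂y^σ` of a fibered chart, extended by zero. -/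
def FiberedChart.coordField (c : FiberedChart n m π)
    (f : EuclideanSpace ℝ (Fin n) × EuclideanSpace ℝ (Fin m) → ℝ) (σ : Fin m) (y : Y) :
    TangentSpace (totalModel n m) y :=
  open Classical in
  if y ∈ c.total.source then
    chartField c.total (fun q => (0, f q • EuclideanSpace.single σ 1)) y
  else 0

namespace FiberedChart

variable {c : FiberedChart n m π}
  {f : EuclideanSpace ℝ (Fin n) × EuclideanSpace ℝ (Fin m) → ℝ} {σ : Fin m}

theorem mfderiv_coordField {y : Y} (hy : y ∈ c.total.source) :
    mfderiv (totalModel n m) (totalModel n m) c.total y (c.coordField f σ y) =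
      ((0, f (c.total y) • EuclideanSpace.single σ 1) :
        EuclideanSpace ℝ (Fin n) × EuclideanSpace ℝ (Fin m)) := by
  rw [coordField, if_pos hy]
  exact mfderiv_chartField c.total_mem _ hy

theorem fieldComp_coordField {q : EuclideanSpace ℝ (Fin n) × EuclideanSpace ℝ (Fin m)}
    (hq : q ∈ c.total.target) (τ : Fin m) :
    c.fieldComp (c.coordField f σ) τ q = if τ = σ then f q else 0 := by
  have h := mfderiv_coordField (f := f) (σ := σ) (c.total.map_target hq)
  rw [c.total.right_inv hq] at h
  rw [fieldComp]
  refine (congrArg (fun w : EuclideanSpace ℝ (Fin n) × EuclideanSpace ℝ (Fin m) => w.2 τ) h).trans ?_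
  simp

theorem isVerticalOn_coordField [T2Space Y] [IsManifold (totalModel n m) ∞ Y]
    (hf : ContDiff ℝ ∞ f) (hc : HasCompactSupport f) (hs : tsupport f ⊆ c.total.target)
    (σ : Fin m) : IsVerticalOn n m π Set.univ (c.coordField f σ) where
  isOpen := isOpen_univ
  smooth := by
    rw [contMDiffOn_univ]
    intro y
    by_cases hy : y ∈ c.total.source
    · refine (contMDiffAt_chartField c.total_mem
        (w := fun q => (0, f q • EuclideanSpace.single σ 1)) hy ?_).congr_of_eventuallyEq ?_
      · exact contDiffAt_const.prodMk (hf.contDiffAt.smul contDiffAt_const)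
      · filter_upwards [c.total.open_source.mem_nhds hy] with z hz
        rw [coordField, if_pos hz]
    · -- off the chart the field vanishes near `y`, since the support of `f` is compact in `Y`
      have hK : IsClosed (c.total.symm '' tsupport f) :=
        (hc.isCompact.image_of_continuousOn (c.total.continuousOn_symm.mono hs)).isClosed
      have hyK : y ∉ c.total.symm '' tsupport f := by
        rintro ⟨q, hq, rfl⟩
        exact hy (c.total.map_target (hs hq))
      refine (Bundle.contMDiff_zeroSection ℝ (TangentSpace (totalModel n m) :
        Y → Type _)).contMDiffAt.congr_of_eventuallyEq ?_
      filter_upwards [hK.isOpen_compl.mem_nhds hyK] with z hz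
      refine congrArg (Bundle.TotalSpace.mk z) ?_
      by_cases hzs : z ∈ c.total.source
      · have hfz : f (c.total z) = 0 := image_eq_zero_of_notMem_tsupport fun h =>
          hz ⟨_, h, c.total.left_inv hzs⟩
        rw [coordField, if_pos hzs, chartField]
        simp only [hfz, zero_smul]
        exact map_zero (mfderiv (totalModel n m) (totalModel n m) c.total.symm (c.total z))
      · rw [coordField, if_neg hzs]
  vertical := by
    intro y _
    by_cases hy : y ∈ c.total.source
    · rw [c.mfderiv_eq_zero_iff hy, mfderiv_coordField hy]
    · rw [coordField, if_neg hy, map_zero]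

end FiberedChart
end Fibered

section EulerLagrangeEquations

variable {n m : ℕ}
  {X : Type*} [TopologicalSpace X] [ChartedSpace (EuclideanSpace ℝ (Fin n)) X]
  {Y : Type*} [TopologicalSpace Y]
  [ChartedSpace (EuclideanSpace ℝ (Fin n) × EuclideanSpace ℝ (Fin m)) Y]
  {π : Y → X} {r : ℕ} (lag : Lagrangian n m π r) {c : FiberedChart n m π} {U : Set X} {γ : X → Y}

theorem Lagrangian.contDiffOn_density (c : FiberedChart n m π) :
    ContDiffOn ℝ ∞ (lag.density c) (c.jetDomain r) :=
  (Classical.choose_spec (lag.smooth c)).1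

/-- Along the jet of a section, the components `d_JΞ^τ` of the prolonged field are the partial
derivatives of the components of `Ξ ∘ γ`. -/
theorem Lagrangian.lieDensity_prolong [IsManifold (totalModel n m) ∞ Y]
    (hγ : IsLocalSection n m π U γ) {Ξ : (y : Y) → TangentSpace (totalModel n m) y}
    (hΞ : IsVerticalOn n m π Set.univ Ξ) {u : EuclideanSpace ℝ (Fin n)}
    (hu : u ∈ c.sectionDomain U γ) :
    lag.lieDensity c Ξ (prolong r (c.sectionComp γ) u) =
      ∑ J : MultiIndex n r, ∑ τ : Fin m,
        basePartialMulti J.1 (fun v => c.fieldComp Ξ τ (c.total (γ (c.base.symm v)))) u *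
          jetPartial J τ (lag.density c) (prolong r (c.sectionComp γ) u) := by
  refine Finset.sum_congr rfl fun J _ => Finset.sum_congr rfl fun τ _ => ?_
  have hV := FiberedChart.isOpen_sectionDomain (c := c) hγ
  have hF : ContDiffOn ℝ ∞ (fun q : JetCoord n m 0 => c.fieldComp Ξ τ (jetPoint q))
      (c.jetDomain 0) :=
    (c.contDiffOn_fieldComp hΞ.isOpen hΞ.smooth τ).comp contDiff_jetPoint.contDiffOn
      fun q hq => ⟨hq, Set.mem_univ _⟩
  rw [totalDerivMulti_prolong hV (FiberedChart.contDiffOn_sectionComp hγ) (c.isOpen_jetDomain 0) hF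
    (FiberedChart.mapsTo_prolong_sectionComp hγ 0) J.1 _ hu]
  congr 1
  refine eqOn_basePartialMulti hV (fun v hv => ?_) J.1 hu
  rw [Function.comp_apply, FiberedChart.jetPoint_prolong_sectionComp hγ 0 hv]

theorem basePartialMulti_zero_fun (J : Fin n → ℕ) (u : EuclideanSpace ℝ (Fin n)) :
    basePartialMulti J 0 u = 0 :=
  image_eq_zero_of_notMem_tsupport fun h => by
    have h' := tsupport_foldr_basePartial_subset 0 (indexList J) h
    simp at h'

/-- The weak Euler--Lagrange equations: on a region `B` of the base chart over which some cutoff `b`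
in the fibre coordinates equals `1` along `γ`, the first variation vanishes for the fields
`g(x) b(y) ∂/∂y^σ`. -/
theorem integral_basePartialMulti_mul_eq_zero [T2Space X] [T2Space Y]
    [IsManifold (totalModel n m) ∞ Y] {lag : Lagrangian n m π r}
    (hγ : IsLocalSection n m π U γ) (hext : IsExtremal lag U γ)
    {b : EuclideanSpace ℝ (Fin m) → ℝ} (hb : ContDiff ℝ ∞ b) (hbc : HasCompactSupport b)
    {B : Set (EuclideanSpace ℝ (Fin n))} (hBV : B ⊆ c.sectionDomain U γ)
    (hBt : B ×ˢ tsupport b ⊆ c.total.target)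
    (hBb : ∀ u ∈ B, b (c.total (γ (c.base.symm u))).2 = 1)
    {g : EuclideanSpace ℝ (Fin n) → ℝ} (hg : ContDiff ℝ ∞ g) (hgc : HasCompactSupport g)
    (hgB : tsupport g ⊆ B) (σ : Fin m) :
    ∫ u, ∑ J : MultiIndex n r, basePartialMulti J.1 g u *
      (jetPartial J σ (lag.density c) ∘ prolong r (c.sectionComp γ)) u = 0 := by
  have hV := FiberedChart.isOpen_sectionDomain (c := c) hγ
  set f : EuclideanSpace ℝ (Fin n) × EuclideanSpace ℝ (Fin m) → ℝ := fun q => g q.1 * b q.2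
  have hfs : tsupport f ⊆ tsupport g ×ˢ tsupport b := by
    refine closure_minimal (fun q hq => ?_)
      ((isClosed_tsupport g).prod (isClosed_tsupport b))
    exact ⟨subset_tsupport _ (left_ne_zero_of_mul hq), subset_tsupport _ (right_ne_zero_of_mul hq)⟩
  have hfc : HasCompactSupport f :=
    (hgc.isCompact.prod hbc.isCompact).of_isClosed_subset (isClosed_tsupport f) hfs
  have hf : ContDiff ℝ ∞ f := (hg.comp contDiff_fst).mul (hb.comp contDiff_snd)
  have hft : tsupport f ⊆ c.total.target :=
    hfs.trans ((Set.prod_mono_left hgB).trans hBt)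
  have hΞ := FiberedChart.isVerticalOn_coordField (c := c) hf hfc hft σ
  have hgV : tsupport g ⊆ c.sectionDomain U γ := hgB.trans hBV
  have hgt : tsupport g ⊆ c.base.target := fun u hu => (hgV hu).1
  have hDc : IsCompact (c.base.symm '' tsupport g) :=
    hgc.isCompact.image_of_continuousOn (c.base.continuousOn_symm.mono hgt)
  have himage : c.base '' (c.base.symm '' tsupport g) = tsupport g := by
    rw [Set.image_image]
    exact (Set.image_congr fun u hu => c.base.right_inv (hgt hu)).trans (Set.image_id' _)
  have key := hext c (c.base.symm '' tsupport g) hDc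
    (by rintro _ ⟨u, hu, rfl⟩; exact (hgV hu).2.1)
    (by rintro _ ⟨u, hu, rfl⟩; exact (hgV hu).2.2)
    (c.coordField f σ) hΞ (by
      refine closure_minimal ?_ hDc.isClosed
      rintro x ⟨hxU, hx⟩
      have hs : γ x ∈ c.total.source := by
        by_contra h
        exact hx (if_neg h)
      have hxb : x ∈ c.base.source := hγ.section_eq x hxU ▸ c.mapsTo hs
      have hfx : f (c.total (γ x)) ≠ 0 := by
        intro h
        refine hx ?_
        rw [FiberedChart.coordField, if_pos hs, chartField]
        simp only [h, zero_smul]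
        exact map_zero (mfderiv (totalModel n m) (totalModel n m) c.total.symm (c.total (γ x)))
      have hgx : g (c.base x) ≠ 0 := by
        have := left_ne_zero_of_mul hfx
        rwa [← c.base_proj _ hs, hγ.section_eq x hxU] at this
      exact ⟨c.base x, subset_tsupport _ hgx, c.base.left_inv hxb⟩)
  rw [himage] at key
  -- on the whole section domain, the components of the field along `γ` are `g` and zeros
  have hcomp : ∀ τ, Set.EqOn
      (fun v => c.fieldComp (c.coordField f σ) τ (c.total (γ (c.base.symm v))))
      (if τ = σ then g else 0) (c.sectionDomain U γ) := by
    intro τ v hv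
    change c.fieldComp _ _ _ = _
    rw [FiberedChart.fieldComp_coordField (c.total.map_source hv.2.2)]
    split_ifs with hτ
    · change g (c.total (γ (c.base.symm v))).1 * b (c.total (γ (c.base.symm v))).2 = g v
      rw [← c.base_proj _ hv.2.2, hγ.section_eq _ hv.2.1, c.base.right_inv hv.1]
      by_cases hvB : v ∈ B
      · rw [hBb v hvB, mul_one]
      · rw [image_eq_zero_of_notMem_tsupport fun h => hvB (hgB h), zero_mul]
    · rfl
  refine Eq.trans (setIntegral_eq_integral_of_forall_compl_eq_zero (s := tsupport g) ?_).symm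
    (Eq.trans ?_ key)
  · intro u hu
    refine Finset.sum_eq_zero fun J _ => ?_
    have h : basePartialMulti J.1 g u = 0 := image_eq_zero_of_notMem_tsupport fun h =>
      hu (tsupport_foldr_basePartial_subset g (indexList J.1) h)
    rw [h, zero_mul]
  · refine setIntegral_congr_fun (isClosed_tsupport g).measurableSet fun u hu => ?_
    have huV := hgV hu
    symm
    rw [c.jetOf_eq_prolong, c.base.right_inv huV.1, lag.lieDensity_prolong hγ hΞ huV]
    refine Finset.sum_congr rfl fun J _ => ?_
    rw [Finset.sum_eq_single σ]
    · rw [eqOn_basePartialMulti hV (hcomp σ) J.1 huV, if_pos rfl, Function.comp_apply]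
    · intro τ _ hτ
      rw [eqOn_basePartialMulti hV (hcomp τ) J.1 huV, if_neg hτ, basePartialMulti_zero_fun, zero_mul]
    · simp

/-- The Euler--Lagrange expressions vanish along an extremal. -/
theorem IsExtremal.eulerLagrange_eq_zero [T2Space X] [T2Space Y]
    [IsManifold (totalModel n m) ∞ Y] {lag : Lagrangian n m π r}
    (hext : IsExtremal lag U γ) (hγ : IsLocalSection n m π U γ) (σ : Fin m)
    {u : EuclideanSpace ℝ (Fin n)} (hu : u ∈ c.sectionDomain U γ) :
    eulerLagrange r (lag.density c) σ (prolong (r + r) (c.sectionComp γ) u) = 0 := by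
  have hV := FiberedChart.isOpen_sectionDomain (c := c) hγ
  have hφ := FiberedChart.contDiffOn_sectionComp (c := c) hγ
  have hmaps := FiberedChart.mapsTo_prolong_sectionComp (c := c) hγ r
  -- the section in coordinates, as a map of the base chart into the total chart
  set s : EuclideanSpace ℝ (Fin n) → EuclideanSpace ℝ (Fin n) × EuclideanSpace ℝ (Fin m) :=
    fun v => c.total (γ (c.base.symm v))
  have hs : ContinuousAt s u := by
    have h := (contDiff_jetPoint.continuous.comp_continuousOn
      (contDiffOn_prolong hV hφ 0).continuousOn).congr fun v hv =>
        (FiberedChart.jetPoint_prolong_sectionComp hγ 0 hv).symm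
    exact h.continuousAt (hV.mem_nhds hu)
  have hsu : s u = (u, (s u).2) := by
    refine Prod.ext ?_ rfl
    change (c.total _).1 = u
    rw [← c.base_proj _ hu.2.2, hγ.section_eq _ hu.2.1, c.base.right_inv hu.1]
  have htarget : c.total.target ∈ 𝓝 (u, (s u).2) :=
    c.total.open_target.mem_nhds (hsu ▸ c.total.map_source hu.2.2)
  obtain ⟨A, hA, K, hK, hAK⟩ := mem_nhds_prod_iff.1 htarget
  obtain ⟨ρ, hρ, hρK⟩ := Metric.nhds_basis_closedBall.mem_iff.1 hK
  -- a cutoff in the fibre that equals `1` near the value of the section at `u`; shrinking the base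
  -- neighbourhood to `B` keeps the section where the cutoff is `1`
  let b : ContDiffBump (s u).2 := ⟨ρ / 2, ρ, half_pos hρ, half_lt_self hρ⟩
  have hnear : c.sectionDomain U γ ∩ A ∩ {v | (s v).2 ∈ Metric.closedBall (s u).2 b.rIn} ∈ 𝓝 u :=
    Filter.inter_mem (Filter.inter_mem (hV.mem_nhds hu) hA)
      ((continuous_snd.continuousAt.comp hs).preimage_mem_nhds
        (Metric.closedBall_mem_nhds _ b.rIn_pos))
  obtain ⟨B, hB, hBo, huB⟩ := mem_nhds_iff.1 hnear
  have hBV : B ⊆ c.sectionDomain U γ := fun v hv => (hB hv).1.1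
  have hP : ∀ J : MultiIndex n r, ContDiffOn ℝ ∞
      (jetPartial J σ (lag.density c) ∘ prolong r (c.sectionComp γ)) B := fun J =>
    ((contDiffOn_jetPartial (c.isOpen_jetDomain r) (lag.contDiffOn_density c) J σ).comp
      (contDiffOn_prolong hV hφ r) hmaps).mono hBV
  rw [eulerLagrange_prolong hV hφ (c.isOpen_jetDomain r) (lag.contDiffOn_density c) hmaps σ hu]
  refine sum_basePartialMulti_eq_zero_of_weak hBo hP (fun g hg hgc hgB => ?_) u huB
  refine integral_basePartialMulti_mul_eq_zero hγ hext b.contDiff b.hasCompactSupport hBV ?_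
    (fun v hv => b.one_of_mem_closedBall (hB hv).2) hg hgc hgB σ
  rw [b.tsupport_eq]
  exact (Set.prod_mono (fun v hv => (hB hv).1.2) hρK).trans hAK

end EulerLagrangeEquations

/-! ### The Jacobi morphism along an extremal -/

section Jacobi

variable {n m : ℕ}
  {X : Type*} [TopologicalSpace X] [ChartedSpace (EuclideanSpace ℝ (Fin n)) X]
  {Y : Type*} [TopologicalSpace Y]
  [ChartedSpace (EuclideanSpace ℝ (Fin n) × EuclideanSpace ℝ (Fin m)) Y]
  {π : Y → X} {r : ℕ} {lag : Lagrangian n m π r} {c : FiberedChart n m π} {U : Set X} {γ : X → Y}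

theorem IsLocalSection.mono (hγ : IsLocalSection n m π U γ) {U' : Set X} (hU' : IsOpen U')
    (h : U' ⊆ U) : IsLocalSection n m π U' γ :=
  ⟨hU', hγ.smooth.mono h, fun x hx => hγ.section_eq x (h hx)⟩

theorem IsLocalSection.isOpen_inter_preimage (hγ : IsLocalSection n m π U γ) {W : Set Y}
    (hW : IsOpen W) : IsOpen (U ∩ γ ⁻¹' W) :=
  hγ.smooth.continuousOn.isOpen_inter_preimage hγ.isOpen hW

/-- The jets of order `k` in a fibered chart over points of `W`. -/
def FiberedChart.jetDomainOver (c : FiberedChart n m π) (W : Set Y) (k : ℕ) :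
    Set (JetCoord n m k) :=
  jetPoint ⁻¹' (c.total.target ∩ c.total.symm ⁻¹' W)

theorem FiberedChart.isOpen_jetDomainOver {W : Set Y} (hW : IsOpen W) (k : ℕ) :
    IsOpen (c.jetDomainOver W k) :=
  (c.total.isOpen_inter_preimage_symm hW).preimage contDiff_jetPoint.continuous

theorem Lagrangian.contDiffOn_eulerLagrange_density (lag : Lagrangian n m π r)
    (c : FiberedChart n m π) (ρ : Fin m) :
    ContDiffOn ℝ ∞ (eulerLagrange r (lag.density c) ρ) (c.jetDomain (r + r)) :=
  contDiffOn_eulerLagrange (c.isOpen_jetDomain r) (lag.contDiffOn_density c) ρ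

variable [IsManifold (totalModel n m) ∞ Y]

theorem FiberedChart.contDiffOn_fieldComp_jetPoint (c : FiberedChart n m π) {W : Set Y}
    {Ξ : (y : Y) → TangentSpace (totalModel n m) y} (hΞ : IsVerticalOn n m π W Ξ) (ρ : Fin m)
    (k : ℕ) :
    ContDiffOn ℝ ∞ (fun p : JetCoord n m k => c.fieldComp Ξ ρ (jetPoint p))
      (c.jetDomainOver W k) :=
  (c.contDiffOn_fieldComp hΞ.isOpen hΞ.smooth ρ).comp contDiff_jetPoint.contDiffOn fun _ hp => hp

theorem Lagrangian.contDiffOn_contraction (lag : Lagrangian n m π r) (c : FiberedChart n m π)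
    {W : Set Y} {Ξ : (y : Y) → TangentSpace (totalModel n m) y} (hΞ : IsVerticalOn n m π W Ξ) :
    ContDiffOn ℝ ∞ (lag.contraction c Ξ) (c.jetDomainOver W (r + r)) :=
  ContDiffOn.sum fun ρ _ => (c.contDiffOn_fieldComp_jetPoint hΞ ρ _).mul
    ((lag.contDiffOn_eulerLagrange_density c ρ).mono fun _ hp => hp.1)

/-- At a jet where the Euler--Lagrange expressions `E_ρ` vanish, the derivatives of `Ξ^ρ E_ρ` do not
involve derivatives of `Ξ`. -/
theorem Lagrangian.jetPartial_contraction (lag : Lagrangian n m π r) {W : Set Y}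
    {Ξ : (y : Y) → TangentSpace (totalModel n m) y} (hΞ : IsVerticalOn n m π W Ξ)
    {p : JetCoord n m (r + r)} (hp : p ∈ c.jetDomainOver W (r + r))
    (hE : ∀ ρ, eulerLagrange r (lag.density c) ρ p = 0) (J : MultiIndex n (r + r)) (σ : Fin m) :
    jetPartial J σ (lag.contraction c Ξ) p = ∑ ρ : Fin m, c.fieldComp Ξ ρ (jetPoint p) *
      jetPartial J σ (eulerLagrange r (lag.density c) ρ) p := by
  have h₁ : ∀ ρ, DifferentiableAt ℝ
      (fun p : JetCoord n m (r + r) => c.fieldComp Ξ ρ (jetPoint p)) p := fun ρ =>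
    ((c.contDiffOn_fieldComp_jetPoint hΞ ρ _).contDiffAt
      ((FiberedChart.isOpen_jetDomainOver hΞ.isOpen _).mem_nhds hp)).differentiableAt (by simp)
  have h₂ : ∀ ρ, DifferentiableAt ℝ (eulerLagrange r (lag.density c) ρ) p := fun ρ =>
    ((lag.contDiffOn_eulerLagrange_density c ρ).contDiffAt
      ((c.isOpen_jetDomain _).mem_nhds hp.1)).differentiableAt (by simp)
  have h := HasFDerivAt.fun_sum (u := Finset.univ)
    fun ρ _ => (h₁ ρ).hasFDerivAt.mul (h₂ ρ).hasFDerivAt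
  have h' : fderiv ℝ (lag.contraction c Ξ) p = _ := h.fderiv
  rw [jetPartial, h', sum_apply]
  refine Finset.sum_congr rfl fun ρ _ => ?_
  simp [hE ρ, jetPartial]

/-- Along an extremal, the Jacobi morphism depends only on the values of the vertical field along
the extremal. -/
theorem Lagrangian.jacobi_congr [T2Space X] [T2Space Y]
    (hγ : IsLocalSection n m π U γ) (hext : IsExtremal lag U γ) {W₁ W₂ : Set Y}
    {Ξ₁ Ξ₂ : (y : Y) → TangentSpace (totalModel n m) y}
    (h₁ : IsVerticalOn n m π W₁ Ξ₁) (h₂ : IsVerticalOn n m π W₂ Ξ₂)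
    (h : ∀ x ∈ U, γ x ∈ W₁ → γ x ∈ W₂ → Ξ₁ (γ x) = Ξ₂ (γ x))
    {x : X} (hx : x ∈ U) (hx₁ : γ x ∈ W₁) (hx₂ : γ x ∈ W₂) (c : FiberedChart n m π)
    (hxc : γ x ∈ c.total.source) (σ : Fin m) :
    lag.jacobi c Ξ₁ σ (c.jetOf (r + r + (r + r)) γ x) =
      lag.jacobi c Ξ₂ σ (c.jetOf (r + r + (r + r)) γ x) := by
  set U' := U ∩ γ ⁻¹' (W₁ ∩ W₂)
  have hU' : IsOpen U' := hγ.isOpen_inter_preimage (h₁.isOpen.inter h₂.isOpen)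
  have hγ' : IsLocalSection n m π U' γ := hγ.mono hU' Set.inter_subset_left
  have hV := FiberedChart.isOpen_sectionDomain (c := c) hγ'
  have hφ := FiberedChart.contDiffOn_sectionComp (c := c) hγ'
  have hu := FiberedChart.base_mem_sectionDomain (c := c) hγ' ⟨hx, hx₁, hx₂⟩ hxc
  have hmem : ∀ {W : Set Y}, W₁ ∩ W₂ ⊆ W → Set.MapsTo (prolong (r + r) (c.sectionComp γ))
      (c.sectionDomain U' γ) (c.jetDomainOver W (r + r)) := fun hW v hv => by
    rw [FiberedChart.jetDomainOver, Set.mem_preimage]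
    rw [FiberedChart.jetPoint_prolong_sectionComp hγ' _ hv]
    refine ⟨c.total.map_source hv.2.2, ?_⟩
    rw [Set.mem_preimage, c.total.left_inv hv.2.2]
    exact hW hv.2.1.2
  have hm₁ := hmem (W := W₁) Set.inter_subset_left
  have hm₂ := hmem (W := W₂) Set.inter_subset_right
  rw [c.jetOf_eq_prolong, jacobi, jacobi,
    eulerLagrange_prolong hV hφ (FiberedChart.isOpen_jetDomainOver h₁.isOpen _)
      (lag.contDiffOn_contraction c h₁) hm₁ σ hu,
    eulerLagrange_prolong hV hφ (FiberedChart.isOpen_jetDomainOver h₂.isOpen _)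
      (lag.contDiffOn_contraction c h₂) hm₂ σ hu]
  refine Finset.sum_congr rfl fun J _ => ?_
  rw [eqOn_basePartialMulti hV (fun v hv => ?_) J.1 hu]
  have hE : ∀ ρ, eulerLagrange r (lag.density c) ρ (prolong (r + r) (c.sectionComp γ) v) = 0 :=
    fun ρ => hext.eulerLagrange_eq_zero hγ ρ ⟨hv.1, hv.2.1.1, hv.2.2⟩
  rw [Function.comp_apply, Function.comp_apply, lag.jetPartial_contraction h₁ (hm₁ hv) hE,
    lag.jetPartial_contraction h₂ (hm₂ hv) hE]
  refine Finset.sum_congr rfl fun ρ _ => ?_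
  rw [FiberedChart.fieldComp_jetPoint_prolong hγ' _ hv
    (h _ hv.2.1.1 hv.2.1.2.1 hv.2.1.2.2) ρ]

/-! ### Extension of vertical fields along a section -/

/-- Near each point of the section, a vertical field along it extends to the total space: in
charts in which `π` is linear, by components that are constant on the fibres. -/
theorem IsVerticalAlong.exists_extends
    (hπ : Manifold.IsSubmersion (totalModel n m) (𝓡 n) ∞ π) (hγ : IsLocalSection n m π U γ)
    {ν : (x : X) → TangentSpace (totalModel n m) (γ x)} (hν : IsVerticalAlong n m π U γ ν)
    {x : X} (hx : x ∈ U) :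
    ∃ (W : Set Y) (Ξ : (y : Y) → TangentSpace (totalModel n m) y),
      γ x ∈ W ∧ IsVerticalOn n m π W Ξ ∧ Extends U γ ν W Ξ := by
  obtain ⟨F, _, _, hs⟩ := hπ.isSubmersionAt (γ x)
  set e := hs.domChart
  set b := hs.codChart
  have he : e ∈ IsManifold.maximalAtlas (totalModel n m) ∞ Y := hs.domChart_mem_maximalAtlas
  have hb : b ∈ IsManifold.maximalAtlas (𝓡 n) ∞ X := hs.codChart_mem_maximalAtlas
  have hmaps : Set.MapsTo π e.source b.source := hs.mapsto_domChart_source_codChart_source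
  let A : EuclideanSpace ℝ (Fin n) × EuclideanSpace ℝ (Fin m) →L[ℝ] EuclideanSpace ℝ (Fin n) :=
    (ContinuousLinearMap.fst ℝ _ F).comp hs.equiv.toContinuousLinearMap
  have hA : ∀ y ∈ e.source, b (π y) = A (e y) := by
    intro y hy
    have h := hs.writtenInCharts
      (show e y ∈ (e.extend (totalModel n m)).target by simpa using e.map_source hy)
    simpa [e.left_inv hy, e, b, A] using h
  have hvert := fun {y : Y} (hy : y ∈ e.source) v =>
    mfderiv_eq_zero_iff_of_chart he hb A hmaps hA hy v
  have hAγ : ∀ z ∈ U, γ z ∈ e.source → A (e (γ z)) = b z := fun z hz hze => by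
    rw [← hA _ hze, hγ.section_eq z hz]
  -- the components of `ν` as functions on the range of the chart of the base
  let w : EuclideanSpace ℝ (Fin n) → EuclideanSpace ℝ (Fin n) × EuclideanSpace ℝ (Fin m) :=
    fun u => mfderiv (totalModel n m) (totalModel n m) e (γ (b.symm u)) (ν (b.symm u))
  set O : Set (EuclideanSpace ℝ (Fin n)) := b.target ∩ b.symm ⁻¹' (U ∩ γ ⁻¹' e.source)
  have hO : IsOpen O := b.isOpen_inter_preimage_symm (hγ.isOpen_inter_preimage e.open_source)
  have hw : ContDiffOn ℝ ∞ w O := by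
    rintro u ⟨hu, huU, hue⟩
    have h₁ := (hν.smooth.contMDiffAt (hγ.isOpen.mem_nhds huU)).comp u
      (contMDiffAt_symm_of_mem_maximalAtlas hb hu)
    exact (contMDiffAt_mfderiv_chart he (f := fun u => γ (b.symm u))
      (v := fun u => ν (b.symm u)) h₁ hue).contDiffAt.contDiffWithinAt
  have hwA : ∀ u ∈ O, A (w u) = 0 := fun u hu =>
    (hvert hu.2.2 _).1 (hν.vertical _ hu.2.1)
  have hW : IsOpen (e.source ∩ e ⁻¹' (A ⁻¹' O)) :=
    e.isOpen_inter_preimage (hO.preimage A.continuous)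
  refine ⟨e.source ∩ e ⁻¹' (A ⁻¹' O), chartField e (fun q => w (A q)), ?_, ⟨hW, ?_, ?_⟩, ?_⟩
  · have hxe : γ x ∈ e.source := hs.mem_domChart_source
    have hxb : x ∈ b.source := hγ.section_eq x hx ▸ hmaps hxe
    refine ⟨hxe, ?_⟩
    rw [Set.mem_preimage, Set.mem_preimage, hAγ x hx hxe]
    refine ⟨b.map_source hxb, ?_⟩
    rw [Set.mem_preimage, b.left_inv hxb]
    exact ⟨hx, hxe⟩
  · rintro y ⟨hy, hyO⟩
    exact (contMDiffAt_chartField he hy ((hw.contDiffAt (hO.mem_nhds hyO)).comp (e y)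
      A.contDiff.contDiffAt)).contMDiffWithinAt
  · rintro y ⟨hy, hyO⟩
    rw [hvert hy, mfderiv_chartField he _ hy]
    exact hwA _ hyO
  · rintro z hz ⟨hze, -⟩
    have hzb : z ∈ b.source := hγ.section_eq z hz ▸ hmaps hze
    have hwz : w (A (e (γ z))) =
        mfderiv (totalModel n m) (totalModel n m) e (γ z) (ν z) := by
      rw [hAγ z hz hze]
      simp only [w]
      rw [b.left_inv hzb]
    rw [chartField, hwz]
    exact mfderiv_symm_mfderiv he hze (ν z)

end Jacobi

end VarJet

end

open VarJet in
theorem mainTheorem9 {n m : ℕ}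
    {X : Type*} [TopologicalSpace X] [T2Space X] [SecondCountableTopology X]
    [ChartedSpace (EuclideanSpace ℝ (Fin n)) X] [IsManifold (𝓡 n) ∞ X]
    {Y : Type*} [TopologicalSpace Y] [T2Space Y] [SecondCountableTopology Y]
    [ChartedSpace (EuclideanSpace ℝ (Fin n) × EuclideanSpace ℝ (Fin m)) Y]
    [IsManifold (totalModel n m) ∞ Y]
    (π : Y → X) (hπ : IsFiberedManifold n m π)
    (r : ℕ) (lag : Lagrangian n m π r)
    (U : Set X) (γ : X → Y) (hγ : IsLocalSection n m π U γ) (hext : IsExtremal lag U γ) :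
    -- along `γ`, the Jacobi morphism depends only on the values of the field along `γ`
    (∀ (W₁ W₂ : Set Y) (Ξ₁ Ξ₂ : (y : Y) → TangentSpace (totalModel n m) y),
      IsVerticalOn n m π W₁ Ξ₁ → IsVerticalOn n m π W₂ Ξ₂ →
      (∀ x ∈ U, γ x ∈ W₁ → γ x ∈ W₂ → Ξ₁ (γ x) = Ξ₂ (γ x)) →
      ∀ x ∈ U, γ x ∈ W₁ → γ x ∈ W₂ →
        ∀ c : FiberedChart n m π, γ x ∈ c.total.source → ∀ σ : Fin m,
          lag.jacobi c Ξ₁ σ (c.jetOf (r + r + (r + r)) γ x) =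
            lag.jacobi c Ξ₂ σ (c.jetOf (r + r + (r + r)) γ x)) ∧
    -- Jacobi fields along `γ` are well defined
    (∀ ν : (x : X) → TangentSpace (totalModel n m) (γ x), IsVerticalAlong n m π U γ ν →
      (∀ x ∈ U, ∃ (W : Set Y) (Ξ : (y : Y) → TangentSpace (totalModel n m) y),
        γ x ∈ W ∧ IsVerticalOn n m π W Ξ ∧ Extends U γ ν W Ξ) ∧
      (IsJacobiFieldAlong lag U γ ν ↔
        ∀ (W : Set Y) (Ξ : (y : Y) → TangentSpace (totalModel n m) y),
          IsVerticalOn n m π W Ξ → Extends U γ ν W Ξ → JacobiEqAlong lag U γ W Ξ) ∧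
      (∀ (W : Set Y) (Ξ : (y : Y) → TangentSpace (totalModel n m) y),
        IsVerticalOn n m π W Ξ → Extends U γ ν W Ξ → (∀ x ∈ U, γ x ∈ W) →
          (IsJacobiFieldAlong lag U γ ν ↔ JacobiEqAlong lag U γ W Ξ))) := by
  have hall : ∀ ν : (x : X) → TangentSpace (totalModel n m) (γ x), IsJacobiFieldAlong lag U γ ν →
      ∀ (W : Set Y) (Ξ : (y : Y) → TangentSpace (totalModel n m) y),
        IsVerticalOn n m π W Ξ → Extends U γ ν W Ξ → JacobiEqAlong lag U γ W Ξ := by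
    intro ν hJ W Ξ hΞ hE x hx hxW c hxc σ
    obtain ⟨W', Ξ', hxW', hΞ', hE', hJ'⟩ := hJ x hx
    rw [lag.jacobi_congr hγ hext hΞ hΞ'
      (fun z hz hzW hzW' => (hE z hz hzW).trans (hE' z hz hzW').symm) hx hxW hxW' c hxc σ]
    exact hJ' x hx hxW' c hxc σ
  refine ⟨fun W₁ W₂ Ξ₁ Ξ₂ h₁ h₂ h x hx hx₁ hx₂ c hxc σ =>
    lag.jacobi_congr hγ hext h₁ h₂ h hx hx₁ hx₂ c hxc σ, fun ν hν => ⟨fun x hx =>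
      hν.exists_extends hπ.isSubmersion hγ hx, ⟨hall ν, fun h x hx => ?_⟩,
      fun W Ξ hΞ hE hW => ⟨fun hJ => hall ν hJ W Ξ hΞ hE, fun h x hx =>
        ⟨W, Ξ, hW x hx, hΞ, hE, h⟩⟩⟩⟩
  obtain ⟨W, Ξ, hxW, hΞ, hE⟩ := hν.exists_extends hπ.isSubmersion hγ hx
  exact ⟨W, Ξ, hxW, hΞ, hE, h W Ξ hΞ hE⟩
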